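/- A literal over the variables $x_1,\dots,x_n$ is a variable or its negation, a term is a conjunction of literals, and a DNF of size $s$ is a disjunction $T_1\vee\cdots\vee T_s$ of $s$ terms. It is read-$k$ if every variable occurs (negated or not) in at most $k$ of the $s$ terms. A DNF computes a function $f:\{-1,1\}^n\to\{0,1\}$, where the input value $-1$ means true and $1$ means false, and the output value $1$ means true and $0$ means false. For $S\subseteq\{1,\dots,n\}$ let $\hat f(S)=\mathbb{E}_{x}\big[f(x)\prod_{i\in S}x_i\big]$ with $x$ uniform on $\{-1,1\}^n$. For a real number $M$, we say that $f$ is $\varepsilon$-concentrated on $M$ coefficients if there is a family $\mathcal S$ of at most $M$ subsets of $\{1,\dots,n\}$ with $\sum_{S\notin\mathcal S}\hat f(S)^2\le\varepsilon$. **Theorem 1.** There is an absolute constant $C>0$ such that for all integers $n,s,k\ge 0$, every size-$s$ read-$k$ DNF $f$ on $n$ variables and every real $\varepsilon>0$, the function $f$ is $\varepsilon$-concentrated on $$\left(\frac{s}{\varepsilon}\right)^{C\,\log_2\log_2(k+2)\,\log_2(1/\varepsilon)}$$ coefficients (for $s=0$ the DNF is the constant $0$, and we set $0^0=1$ and $0^t=0$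 for $t\ne 0$). -/

import Mathlib

open Finset

/-- The Boolean cube `{-1, 1}ⁿ`; the coordinate value `-1` means "true" and `1` means "false". -/
abbrev Cube (n : ℕ) : Type := Fin n → ℤˣ

/-- The monomial `x^S = ∏_{i ∈ S} x_i`, as a real number. -/
def monomialAt {n : ℕ} (S : Finset (Fin n)) (x : Cube n) : ℝ :=
  ∏ i ∈ S, ((x i : ℤ) : ℝ)

/-- The Fourier coefficient of `f` at `S`: the average of `f(x) x^S` over the uniform
distribution on the cube. -/
noncomputable def fourierCoef {n : ℕ} (f : Cube n → ℝ) (S : Finset (Fin n)) : ℝ :=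
  (∑ x : Cube n, f x * monomialAt S x) / 2 ^ n

/-- `f` is `ε`-concentrated on the family `𝒮`: the squared Fourier coefficients outside `𝒮`
sum to at most `ε`. -/
def ConcentratedOnFamily {n : ℕ} (f : Cube n → ℝ) (ε : ℝ) (𝒮 : Finset (Finset (Fin n))) : Prop :=
  ∑ S ∈ 𝒮ᶜ, fourierCoef f S ^ 2 ≤ ε

/-- `f` is `ε`-concentrated on `M` coefficients (`M` a real number): it is `ε`-concentrated on
some family of at most `M` sets. -/
def ConcentratedOnCoefficients {n : ℕ} (f : Cube n → ℝ) (ε M : ℝ) : Prop :=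
  ∃ 𝒮 : Finset (Finset (Fin n)), (𝒮.card : ℝ) ≤ M ∧ ConcentratedOnFamily f ε 𝒮

/-- A literal on `n` variables: `(i, -1)` is the literal `x_i`, and `(i, 1)` is its negation.
The literal `(i, b)` is true at `x` exactly when `x i = b`. -/
abbrev Literal (n : ℕ) : Type := Fin n × ℤˣ

/-- A term is a conjunction of literals. -/
abbrev Term (n : ℕ) : Type := Finset (Literal n)

/-- The set of variables occurring in a term (positively or negatively). -/
def Term.vars {n : ℕ} (T : Term n) : Finset (Fin n) := T.image Prod.fst

/-- The term `T` is satisfied by the input `x`: all of its literals are true. -/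
def Term.Sat {n : ℕ} (T : Term n) (x : Cube n) : Prop := ∀ l ∈ T, x l.1 = l.2

/-- A DNF formula of size `s` on `n` variables: the disjunction `T₁ ∨ ⋯ ∨ T_s` of `s` terms. -/
abbrev DNF (n s : ℕ) : Type := Fin s → Term n

open Classical in
/-- The function `{-1, 1}ⁿ → {0, 1} ⊆ ℝ` computed by a DNF formula: `1` if some term is satisfied,
`0` otherwise. -/
noncomputable def DNF.toFun {n s : ℕ} (φ : DNF n s) (x : Cube n) : ℝ :=
  if ∃ j, Term.Sat (φ j) x then 1 else 0

/-- A DNF formula is read-`k` if every variable occurs in at most `k` of its terms. -/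
def DNF.IsRead {n s : ℕ} (φ : DNF n s) (k : ℕ) : Prop :=
  ∀ i : Fin n, (univ.filter fun j : Fin s => i ∈ Term.vars (φ j)).card ≤ k

/-!
# Fourier concentration of read-`k` DNF formulas

The idea is to run Håstad's canonical decision tree (`queried`) with a free set `S` and to compare
it with the Fourier coefficient at the *same* set `S`. Branches that do not query all of `S` cancel,
so `|f̂(S)|` is at most the probability that a random point `y` follows a *full* branch, one that
queries all of `S` (`fourierCoef_eq_of_long_branches`).

Full branches are controlled by a switching lemma: summed over all `S` with weight `p ^ #S`, their
probabilities are `O(1)`, provided that every term visited contributes `O(1 / p)` variables not seen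
before (`sum_full_branches_le`). For width `w` one would need `p ≈ 1 / w`, and this only gives
`w ^ O(w)` coefficients. To reach `p ≈ 1 / log k`, the visited terms with at least `m ≈ log k`
new variables, the wide ones, are paid for by a factor `4 / 5` for each of their new variables.
Hence the full branches with fewer than `v₀` variables in wide terms have total weight at most
`2 ^ O(v₀)` times the usual `p ^ (-#S)`.

The read bound makes the remaining branches negligible. For a fixed `S` only `k * #S` terms
meet `S`, and a collection of wide terms with `v` variables in all is alive with probability at most
`2 ^ (#S - v)`, which beats the number of such collections (`sum_pow_wide_le`). By the
Cauchy–Schwarz inequality (`exists_branch_bounds`) the two bounds together show that the branches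
with at least `v₀` variables in wide terms carry little Fourier weight on sets of size `< N` as soon
as `v₀` is of order `N * log log k`.

Finally, terms of more than `O(log (s / ε))` variables may be dropped, and for width `W` the Fourier
weight at degrees above `N = O(W * log (1 / ε))` is negligible (`sum_fourierCoef_sq_high_le`). The
latter also follows from the switching lemma for full branches, because fixing the unqueried
variables turns every branch into a full one (`queried_queried`). The family consists of the sets of
size `< N` with a large weight of full branches, and has
`2 ^ O(v₀) = (s / ε) ^ O(log log k * log (1 / ε))` members.
-/

/-! ### Fourier analysis on the cube -/

lemma monomialAt_sq {n : ℕ} (S : Finset (Fin n)) (y : Cube n) : monomialAt S y ^ 2 = 1 := by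
  unfold monomialAt
  rw [← Finset.prod_pow]
  refine Finset.prod_eq_one fun i _ => ?_
  rcases Int.units_eq_one_or (y i) with h | h <;> simp [h]

lemma abs_monomialAt {n : ℕ} (S : Finset (Fin n)) (y : Cube n) : |monomialAt S y| = 1 := by
  have h := (sq_eq_sq_iff_abs_eq_abs (monomialAt S y) 1).1 (by rw [monomialAt_sq, one_pow])
  rwa [abs_one] at h

lemma sum_monomialAt_mul {n : ℕ} (x y : Cube n) :
    ∑ S : Finset (Fin n), monomialAt S x * monomialAt S y = if x = y then (2 : ℝ) ^ n else 0 := by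
  have h : ∀ S : Finset (Fin n), monomialAt S x * monomialAt S y
      = ∏ i ∈ S, (((x i : ℤ) : ℝ) * ((y i : ℤ) : ℝ)) := fun S => by
    simp [monomialAt, Finset.prod_mul_distrib]
  simp_rw [h]
  rw [← Finset.powerset_univ, ← Finset.prod_one_add]
  split_ifs with hxy
  · subst hxy
    have : ∀ i : Fin n, (1 + ((x i : ℤ) : ℝ) * ((x i : ℤ) : ℝ)) = 2 := fun i => by
      rcases Int.units_eq_one_or (x i) with h | h <;> simp [h] <;> norm_num
    simp [this]
  · obtain ⟨i, hi⟩ := Function.ne_iff.1 hxy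
    refine Finset.prod_eq_zero (mem_univ i) ?_
    rcases Int.units_eq_one_or (x i) with h | h <;> rcases Int.units_eq_one_or (y i) with h' | h' <;>
      simp_all

/-- Parseval's identity. -/
lemma sum_fourierCoef_sq {n : ℕ} (f : Cube n → ℝ) :
    ∑ S, fourierCoef f S ^ 2 = (∑ y, f y ^ 2) / 2 ^ n := by
  have h : ∀ S, fourierCoef f S ^ 2
      = (∑ x, ∑ y, f x * f y * (monomialAt S x * monomialAt S y)) / (2 ^ n) ^ 2 := fun S => by
    rw [fourierCoef, div_pow, sq, Finset.sum_mul_sum]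
    congr 1
    exact Finset.sum_congr rfl fun x _ => Finset.sum_congr rfl fun y _ => by ring
  simp_rw [h]
  rw [← Finset.sum_div, Finset.sum_comm]
  have h2 : ∀ x : Cube n, ∑ S, ∑ y, f x * f y * (monomialAt S x * monomialAt S y)
      = f x ^ 2 * 2 ^ n := fun x => by
    rw [Finset.sum_comm]
    simp_rw [← Finset.mul_sum, sum_monomialAt_mul]
    simp [sq]
  simp_rw [h2, ← Finset.sum_mul]
  field_simp

/-- The number of points of the cube that agree with `c` off `A`. -/
lemma card_agree_off {n : ℕ} (A : Finset (Fin n)) (c : Cube n) :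
    #{z : Cube n | ∀ i ∉ A, z i = c i} = 2 ^ #A := by
  have : ({z : Cube n | ∀ i ∉ A, z i = c i} : Finset (Cube n))
      = Fintype.piFinset fun i => if i ∈ A then univ else {c i} := by
    ext z
    simp only [mem_filter, mem_univ, true_and, Fintype.mem_piFinset]
    refine forall_congr' fun i => ?_
    by_cases h : i ∈ A <;> simp [h, Int.units_eq_one_or]
  rw [this, Fintype.card_piFinset]
  have h2 : ∀ i, #(if i ∈ A then univ else {c i} : Finset ℤˣ) = if i ∈ A then 2 else 1 := fun i => by
    split_ifs <;> simp
  simp_rw [h2]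
  simp

/-- `g` does not depend on the coordinates in `R`. -/
def IndepOf {n : ℕ} (R : Finset (Fin n)) (g : Cube n → ℝ) : Prop :=
  ∀ y z : Cube n, (∀ i ∉ R, y i = z i) → g y = g z

lemma IndepOf.mono {n : ℕ} {R R' : Finset (Fin n)} {g : Cube n → ℝ} (h : IndepOf R g)
    (hR : R' ⊆ R) : IndepOf R' g :=
  fun y z hyz => h y z fun i hi => hyz i fun hi' => hi (hR hi')

lemma IndepOf.add {n : ℕ} {R : Finset (Fin n)} {g h : Cube n → ℝ} (hg : IndepOf R g)
    (hh : IndepOf R h) : IndepOf R fun y => g y + h y :=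
  fun y z hyz => by simp only [hg y z hyz, hh y z hyz]

lemma IndepOf.mul {n : ℕ} {R : Finset (Fin n)} {g h : Cube n → ℝ} (hg : IndepOf R g)
    (hh : IndepOf R h) : IndepOf R fun y => g y * h y :=
  fun y z hyz => by simp only [hg y z hyz, hh y z hyz]

lemma sum_indepOf_mul_monomialAt {n : ℕ} {R S : Finset (Fin n)} {g : Cube n → ℝ}
    (hg : IndepOf R g) (h : (S ∩ R).Nonempty) : ∑ y, g y * monomialAt S y = 0 := by
  obtain ⟨i, hi⟩ := h
  rw [mem_inter] at hi
  -- flipping the coordinate `i` keeps `g` and changes the sign of the monomial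
  let e : Equiv.Perm (Cube n) := Function.Involutive.toPerm
    (fun y => Function.update y i (-(y i))) (fun y => by simp)
  have he : ∀ y, e y = Function.update y i (-(y i)) := fun y => rfl
  have key : ∑ y, g y * monomialAt S y = ∑ y, -(g y * monomialAt S y) := by
    refine (Equiv.sum_comp e _).symm.trans (Finset.sum_congr rfl fun y _ => ?_)
    have h1 : g (e y) = g y := hg _ _ fun j hj => by
      rw [he, Function.update_of_ne]
      rintro rfl
      exact hj hi.2
    have h2 : monomialAt S (e y) = -monomialAt S y := by
      unfold monomialAt
      rw [← Finset.mul_prod_erase _ _ hi.1, ← Finset.mul_prod_erase S _ hi.1, he]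
      have : ∏ j ∈ S.erase i, ((Function.update y i (-(y i)) j : ℤ) : ℝ)
          = ∏ j ∈ S.erase i, ((y j : ℤ) : ℝ) :=
        Finset.prod_congr rfl fun j hj => by rw [Function.update_of_ne (ne_of_mem_erase hj)]
      rw [this]
      simp
    rw [h1, h2, mul_neg]
  rw [Finset.sum_neg_distrib] at key
  linarith

/-! ### The canonical queries of a DNF -/

/-- Every literal of `T` whose variable lies outside `R` is satisfied by `y`: the term `T` is not
falsified when the variables in `R` are left free and the others are fixed as in `y`. -/
def Term.SatOff {n : ℕ} (T : Term n) (R : Finset (Fin n)) (y : Cube n) : Prop :=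
  ∀ l ∈ T, l.1 ∉ R → y l.1 = l.2

lemma Term.SatOff.mono {n : ℕ} {T : Term n} {R R' : Finset (Fin n)} {y : Cube n}
    (h : T.SatOff R y) (hR : R ⊆ R') : T.SatOff R' y :=
  fun l hl hlR => h l hl fun h' => hlR (hR h')

lemma Term.mem_vars {n : ℕ} {T : Term n} {l : Literal n} (h : l ∈ T) : l.1 ∈ T.vars :=
  mem_image_of_mem _ h

lemma Term.SatOff.sat {n : ℕ} {T : Term n} {R : Finset (Fin n)} {y : Cube n}
    (h : T.SatOff R y) (hR : Disjoint T.vars R) : T.Sat y :=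
  fun l hl => h l hl (disjoint_left.1 hR (T.mem_vars hl))

lemma Term.SatOff.congr {n : ℕ} {T : Term n} {R : Finset (Fin n)} {y z : Cube n}
    (h : T.SatOff R y) (hyz : ∀ i ∉ R, z i = y i) : T.SatOff R z :=
  fun l hl hlR => (hyz _ hlR).trans (h l hl hlR)

open Classical in
/-- The variables queried by the canonical decision tree of the DNF with list of terms `l`, with
the variables in `R` free and the others fixed as in `y`, along the branch given by the values of
`y` on `R`: the tree queries all free variables of the first term that is not yet falsified and
goes on with the terms after it, until it reaches a satisfied term. -/
noncomputable def queried {n : ℕ} : List (Term n) → Finset (Fin n) → Cube n → Finset (Fin n)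
  | [], _, _ => ∅
  | T :: l, R, y =>
    if T.SatOff R y then
      if Disjoint T.vars R then ∅ else (T.vars ∩ R) ∪ queried l (R \ T.vars) y
    else queried l R y

/-- The contribution to `wide` of a term with `t` new variables. -/
def wideCost (m t : ℕ) : ℕ := if m ≤ t then t else 0

open Classical in
/-- The number of variables contributed by the wide terms among those visited by the canonical
decision tree of `queried`. Here `V` is the set of the variables of the terms visited before, and a
term is wide if it has at least `m` variables outside `V`. -/
noncomputable def wide {n : ℕ} (m : ℕ) :
    List (Term n) → Finset (Fin n) → Finset (Fin n) → Cube n → ℕ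
  | [], _, _, _ => 0
  | T :: l, V, R, y =>
    if T.SatOff R y then
      if Disjoint T.vars R then 0
      else wideCost m #(T.vars \ V) + wide m l (V ∪ T.vars) (R \ T.vars) y
    else wide m l V R y

lemma queried_subset {n : ℕ} (l : List (Term n)) (R : Finset (Fin n)) (y : Cube n) :
    queried l R y ⊆ R := by
  induction l generalizing R with
  | nil => simp [queried]
  | cons T l ih =>
    rw [queried]
    split_ifs
    · exact empty_subset _
    · exact union_subset inter_subset_right ((ih _).trans sdiff_subset)
    · exact ih _

/-- Fixing the unqueried variables beforehand does not change what is queried. -/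
lemma queried_queried {n : ℕ} (l : List (Term n)) (R : Finset (Fin n)) (y : Cube n) :
    queried l (queried l R y) y = queried l R y := by
  induction l generalizing R with
  | nil => simp [queried]
  | cons T l ih =>
    by_cases hT : T.SatOff R y
    · by_cases hd : Disjoint T.vars R
      · have h1 : queried (T :: l) R y = ∅ := by rw [queried, if_pos hT, if_pos hd]
        rw [h1]
        exact subset_empty.1 (queried_subset _ _ _)
      · set Q := queried l (R \ T.vars) y with hQ
        have hQR : Q ⊆ R \ T.vars := queried_subset _ _ _
        have h1 : queried (T :: l) R y = (T.vars ∩ R) ∪ Q := by rw [queried, if_pos hT, if_neg hd]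
        have hdiff : ((T.vars ∩ R) ∪ Q) \ T.vars = Q := by
          ext i
          have := @hQR i
          simp only [mem_sdiff, mem_union, mem_inter] at *
          tauto
        have hint : T.vars ∩ ((T.vars ∩ R) ∪ Q) = T.vars ∩ R := by
          ext i
          have := @hQR i
          simp only [mem_sdiff, mem_union, mem_inter] at *
          tauto
        have hT' : T.SatOff ((T.vars ∩ R) ∪ Q) y := fun x hx hxR => hT x hx fun h =>
          hxR (mem_union_left _ (mem_inter.2 ⟨T.mem_vars hx, h⟩))
        have hd' : ¬ Disjoint T.vars ((T.vars ∩ R) ∪ Q) := by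
          rw [disjoint_iff_inter_eq_empty, hint, ← disjoint_iff_inter_eq_empty]
          exact hd
        rw [h1, queried, if_pos hT', if_neg hd', hdiff, hint, hQ, ih]
    · have h1 : queried (T :: l) R y = queried l R y := by rw [queried, if_neg hT]
      rw [h1, queried, if_neg (fun h => hT (h.mono (queried_subset _ _ _))), ih]

open Classical in
/-- The function computed by the disjunction of the terms in a list. -/
noncomputable def listFun {n : ℕ} (l : List (Term n)) (y : Cube n) : ℝ :=
  if ∃ T ∈ l, T.Sat y then 1 else 0

lemma listFun_sq_le_one {n : ℕ} (l : List (Term n)) (y : Cube n) : listFun l y ^ 2 ≤ 1 := by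
  unfold listFun
  split_ifs <;> simp

lemma abs_listFun_le_one {n : ℕ} (l : List (Term n)) (y : Cube n) : |listFun l y| ≤ 1 := by
  unfold listFun
  split_ifs <;> simp

lemma indepOf_ite_satOff {n : ℕ} (T : Term n) (R : Finset (Fin n)) [DecidablePred (T.SatOff R)]
    (a b : ℝ) : IndepOf R fun y => if T.SatOff R y then a else b := fun y z hyz => by
  have : T.SatOff R y ↔ T.SatOff R z :=
    ⟨fun h => h.congr fun i hi => (hyz i hi).symm, fun h => h.congr hyz⟩
  simp only [this]

open Classical in
/-- The branches of the canonical decision tree with fewer than `t` queries contribute nothing to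
a Fourier coefficient at a set with at least `t` free elements. The multipliers `g₁` and `g₂` carry
the terms that have been visited before. -/
lemma sum_short_branches_eq_zero {n : ℕ} (l : List (Term n)) (R S : Finset (Fin n)) (t : ℕ)
    (ht : t ≤ #(S ∩ R)) (g₁ g₂ : Cube n → ℝ) (h₁ : IndepOf R g₁) (h₂ : IndepOf R g₂) :
    ∑ y, (g₁ y + g₂ y * listFun l y) * monomialAt S y * (if #(queried l R y) < t then 1 else 0)
      = 0 := by
  induction l generalizing R t g₁ g₂ with
  | nil =>
    by_cases h0 : 0 < t
    · simp only [queried, listFun, card_empty, h0, if_true, mul_one, List.not_mem_nil, false_and,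
        exists_false, if_false, mul_zero, add_zero]
      exact sum_indepOf_mul_monomialAt h₁ (card_pos.1 (h0.trans_le ht))
    · simp [queried, h0]
  | cons T l ih =>
    -- the points at which `T` is falsified off `R`; the terms after `T` are left
    have hdead := ih R t ht (fun y => g₁ y * if T.SatOff R y then 0 else 1)
      (fun y => g₂ y * if T.SatOff R y then 0 else 1)
      (h₁.mul (indepOf_ite_satOff _ _ _ _)) (h₂.mul (indepOf_ite_satOff _ _ _ _))
    by_cases hd : Disjoint T.vars R
    · by_cases h0 : 0 < t
      · have hconst := sum_indepOf_mul_monomialAt (S := S)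
          ((h₁.add h₂).mul (indepOf_ite_satOff T R 1 0)) (card_pos.1 (h0.trans_le ht))
        refine Eq.trans ?_ ((congrArg₂ HAdd.hAdd hdead hconst).trans (add_zero 0))
        rw [← Finset.sum_add_distrib]
        refine Finset.sum_congr rfl fun y _ => ?_
        by_cases hT : T.SatOff R y
        · have hf : listFun (T :: l) y = 1 := if_pos ⟨T, by simp, hT.sat hd⟩
          simp only [queried, hT, hd, hf, h0, if_true, card_empty]
          ring
        · have hf : listFun (T :: l) y = listFun l y := by
            have : ¬ T.Sat y := fun h => hT fun l hl _ => h l hl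
            simp [listFun, this]
          simp only [queried, hT, hf, if_false]
          ring
      · exact Finset.sum_eq_zero fun y _ => by rw [if_neg (by omega), mul_zero]
    · have hR : R \ T.vars ⊆ R := sdiff_subset
      have hS : t - #(T.vars ∩ R) ≤ #(S ∩ (R \ T.vars)) := by
        have : S ∩ R ⊆ (S ∩ (R \ T.vars)) ∪ (T.vars ∩ R) := fun i => by
          simp only [mem_union, mem_inter, mem_sdiff]
          tauto
        have := (card_le_card this).trans (card_union_le _ _)
        omega
      have hsat : IndepOf (R \ T.vars) fun y => if T.Sat y then (1 : ℝ) else 0 := fun y z hyz => by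
        have : T.Sat y ↔ T.Sat z := forall₂_congr fun x hx => by
          rw [hyz x.1 (by simp [T.mem_vars hx])]
        simp only [this]
      have hsat' : IndepOf (R \ T.vars) fun y => if T.Sat y then (0 : ℝ) else 1 := fun y z hyz => by
        have : T.Sat y ↔ T.Sat z := forall₂_congr fun x hx => by
          rw [hyz x.1 (by simp [T.mem_vars hx])]
        simp only [this]
      -- the points at which `T` is queried: `f = T + (1 - T) f'`, where `f'` is the rest of the DNF
      -- and `T` does not depend on the variables that are still free
      have halive := ih (R \ T.vars) (t - #(T.vars ∩ R)) hS
        (fun y => (g₁ y + g₂ y * if T.Sat y then 1 else 0) * if T.SatOff R y then 1 else 0)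
        (fun y => (g₂ y * if T.Sat y then 0 else 1) * if T.SatOff R y then 1 else 0)
        (((h₁.mono hR).add ((h₂.mono hR).mul hsat)).mul ((indepOf_ite_satOff _ _ _ _).mono hR))
        (((h₂.mono hR).mul hsat').mul ((indepOf_ite_satOff _ _ _ _).mono hR))
      refine Eq.trans ?_ ((congrArg₂ HAdd.hAdd hdead halive).trans (add_zero 0))
      rw [← Finset.sum_add_distrib]
      refine Finset.sum_congr rfl fun y _ => ?_
      by_cases hT : T.SatOff R y
      · have hcard : #(queried (T :: l) R y)
            = #(T.vars ∩ R) + #(queried l (R \ T.vars) y) := by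
          rw [queried, if_pos hT, if_neg hd, card_union_of_disjoint]
          refine disjoint_left.2 fun i hi hi' => ?_
          exact (mem_sdiff.1 (queried_subset _ _ _ hi')).2 (mem_inter.1 hi).1
        have hiff : #(queried (T :: l) R y) < t
            ↔ #(queried l (R \ T.vars) y) < t - #(T.vars ∩ R) := by omega
        by_cases hs : T.Sat y
        · have hf : listFun (T :: l) y = 1 := if_pos ⟨T, by simp, hs⟩
          simp only [hiff, hT, hf, hs, if_true]
          ring
        · have hf : listFun (T :: l) y = listFun l y := by simp [listFun, hs]
          simp only [hiff, hT, hf, hs, if_true, if_false]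
          ring
      · have hf : listFun (T :: l) y = listFun l y := by
          have : ¬ T.Sat y := fun h => hT fun l hl _ => h l hl
          simp [listFun, this]
        simp only [queried, hT, hf, if_false]
        ring

open Classical in
lemma fourierCoef_eq_of_long_branches {n : ℕ} (l : List (Term n)) (R S : Finset (Fin n)) (t : ℕ)
    (ht : t ≤ #(S ∩ R)) :
    fourierCoef (listFun l) S
      = fourierCoef (fun y => if t ≤ #(queried l R y) then listFun l y else 0) S := by
  have h := sum_short_branches_eq_zero l R S t ht (fun _ => 0) (fun _ => 1)
    (fun _ _ _ => rfl) (fun _ _ _ => rfl)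
  unfold fourierCoef
  congr 1
  refine sub_eq_zero.1 (Eq.trans ?_ h)
  rw [← Finset.sum_sub_distrib]
  refine Finset.sum_congr rfl fun y _ => ?_
  by_cases hy : t ≤ #(queried l R y)
  · simp [hy, not_lt.2 hy]
  · simp [hy, not_le.1 hy]

/-! ### A switching lemma for full branches -/

open Classical in
/-- The weight of the pair `(S, y)` in `sum_branchWeight_le`. It is nonzero only if all of `S` is
queried and the subcube through `y` with free coordinates `S` lies in `Q`. -/
noncomputable def branchWeight {n : ℕ} (m : ℕ) (p q : ℝ) (l : List (Term n))
    (V : Finset (Fin n)) (Q : Finset (Cube n)) (S : Finset (Fin n)) (y : Cube n) : ℝ :=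
  if queried l S y = S ∧ ∀ z : Cube n, (∀ i ∉ S, z i = y i) → z ∈ Q then
    p ^ #S * q ^ wide m l V S y
  else 0

lemma branchWeight_nonneg {n : ℕ} (m : ℕ) {p q : ℝ} (hp : 0 ≤ p) (hq : 0 ≤ q) (l : List (Term n))
    (V : Finset (Fin n)) (Q : Finset (Cube n)) (S : Finset (Fin n)) (y : Cube n) :
    0 ≤ branchWeight m p q l V Q S y := by
  unfold branchWeight
  split_ifs <;> positivity

lemma sum_ite_empty_mem {n : ℕ} (V : Finset (Fin n)) (Q : Finset (Cube n)) :
    ∑ S ∈ Vᶜ.powerset, ∑ y, (if S = ∅ ∧ y ∈ Q then (1 : ℝ) else 0) = #Q := by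
  rw [Finset.sum_eq_single ∅]
  · simp
  · intro S _ hS
    simp [hS]
  · simp

/-- Splitting a set disjoint from `V` into its parts inside and outside of `X`. -/
lemma sum_powerset_compl_split {n : ℕ} (V X : Finset (Fin n))
    (G : Finset (Fin n) → Finset (Fin n) → ℝ) :
    ∑ S ∈ Vᶜ.powerset, G (X ∩ S) (S \ X)
      = ∑ A ∈ (X \ V).powerset, ∑ S ∈ (V ∪ X)ᶜ.powerset, G A S := by
  rw [← Finset.sum_product']
  refine Finset.sum_bij' (fun S _ => (X ∩ S, S \ X)) (fun P _ => P.1 ∪ P.2) ?_ ?_ ?_ ?_ ?_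
  · intro S hS
    simp only [mem_product, mem_powerset, subset_iff, mem_compl, mem_inter, mem_sdiff,
      mem_union] at *
    exact ⟨fun i hi => ⟨hi.1, hS hi.2⟩, fun i hi => not_or.2 ⟨hS hi.1, hi.2⟩⟩
  · rintro ⟨A, S⟩ hS
    simp only [mem_product, mem_powerset, subset_iff, mem_compl, mem_sdiff, mem_union] at *
    rintro i (hi | hi)
    · exact (hS.1 hi).2
    · exact fun h => hS.2 hi (Or.inl h)
  · intro S _
    ext i
    simp only [mem_union, mem_inter, mem_sdiff]
    tauto
  · rintro ⟨A, S⟩ hS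
    simp only [mem_product, mem_powerset, subset_iff, mem_compl, mem_sdiff, mem_union] at hS
    simp only [Prod.mk.injEq]
    constructor
    · ext i
      have h1 := @hS.1 i
      have h2 := @hS.2 i
      simp only [mem_union, mem_inter]
      tauto
    · ext i
      have h1 := @hS.1 i
      have h2 := @hS.2 i
      simp only [mem_union, mem_sdiff]
      tauto
  · intros
    rfl

lemma sum_powerset_pow_card {α : Type*} (B : Finset α) (x : ℝ) :
    ∑ A ∈ B.powerset, x ^ #A = (1 + x) ^ #B := by
  rw [← Finset.prod_const, Finset.prod_one_add]
  simp

/-- The points that fall into `Q` when their coordinates in `A` are overwritten by those of `c`. -/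
lemma card_overwrite_le {n : ℕ} (A : Finset (Fin n)) (c : Cube n) (Q : Finset (Cube n)) :
    #{z : Cube n | (fun i => if i ∈ A then c i else z i) ∈ Q} ≤ 2 ^ #A * #Q := by
  classical
  refine Finset.card_le_mul_card_image_of_maps_to
    (f := fun (z : Cube n) i => if i ∈ A then c i else z i) (fun z hz => (mem_filter.1 hz).2) _ ?_
  intro b _
  rw [← card_agree_off A b]
  refine card_le_card fun z hz => ?_
  simp only [mem_filter, mem_univ, true_and] at hz ⊢
  intro i hi
  rw [← hz.2]
  simp [hi]

open Classical in
/-- Weighted count of the pairs `(S, y)` for which the canonical decision tree queries all of the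
free set `S`. As in Håstad's switching lemma, a pair is charged to the point obtained from `y` by
setting the queried variables so that the visited terms are satisfied: that point determines each
visited term, so only the set of its free variables and their values have to be recorded, and
`hpq` makes these records cost at most `1/2` per visited term. The set `Q` keeps track of the terms
passed before, which the points charged must not satisfy. -/
lemma sum_branchWeight_le {n : ℕ} (m W : ℕ) {p q : ℝ} (hp : 0 ≤ p) (hq : 0 ≤ q)
    (hpq : ∀ t ≤ W, q ^ wideCost m t * ((1 + 2 * p) ^ t - 1) ≤ 1 / 2)
    (l : List (Term n)) (hsat : ∀ T ∈ l, ∃ y, T.Sat y) (hW : ∀ T ∈ l, #T.vars ≤ W)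
    (V : Finset (Fin n)) (Q : Finset (Cube n)) :
    ∑ S ∈ Vᶜ.powerset, ∑ y, branchWeight m p q l V Q S y ≤ 2 * #Q := by
  induction l generalizing V Q with
  | nil =>
    calc ∑ S ∈ Vᶜ.powerset, ∑ y, branchWeight m p q [] V Q S y
        ≤ ∑ S ∈ Vᶜ.powerset, ∑ y, (if S = ∅ ∧ y ∈ Q then (1 : ℝ) else 0) := by
          refine Finset.sum_le_sum fun S _ => Finset.sum_le_sum fun y _ => ?_
          unfold branchWeight
          split_ifs with h h' h'
          · simp [h'.1, wide]
          · exact absurd ⟨h.1.symm, h.2 y fun _ _ => rfl⟩ h'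
          · exact zero_le_one
          · exact le_rfl
      _ = #Q := sum_ite_empty_mem V Q
      _ ≤ 2 * #Q := by linarith [Nat.cast_nonneg (α := ℝ) #Q]
  | cons T l ih =>
    have hl : ∀ T' ∈ l, ∃ y, T'.Sat y := fun T' h => hsat T' (List.mem_cons_of_mem _ h)
    have hlW : ∀ T' ∈ l, #T'.vars ≤ W := fun T' h => hW T' (List.mem_cons_of_mem _ h)
    obtain ⟨c, hc⟩ := hsat T List.mem_cons_self
    set Q₀ := Q.filter fun z => ¬ T.Sat z with hQ₀
    set Q₁ := Q.filter fun z => T.Sat z with hQ₁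
    let Q' : Finset (Fin n) → Finset (Cube n) := fun A =>
      {z : Cube n | (fun i => if i ∈ A then c i else z i) ∈ Q₁}
    set w : ℝ := q ^ wideCost m #(T.vars \ V) with hw
    have hw0 : 0 ≤ w := by positivity
    let G : Finset (Fin n) → Finset (Fin n) → ℝ := fun A S =>
      if A.Nonempty then p ^ #A * w * ∑ y, branchWeight m p q l (V ∪ T.vars) (Q' A) S y else 0
    -- `T` is falsified off `S`, or satisfied with none of its variables free, or queried at
    -- `A = T.vars ∩ S`; in the last case the charged point takes the values of `c` on `A`
    have hpoint : ∀ S y, branchWeight m p q (T :: l) V Q S y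
        ≤ branchWeight m p q l V Q₀ S y + (if S = ∅ ∧ y ∈ Q₁ then (1 : ℝ) else 0)
          + (if (T.vars ∩ S).Nonempty then p ^ #(T.vars ∩ S) * w *
              branchWeight m p q l (V ∪ T.vars) (Q' (T.vars ∩ S)) (S \ T.vars) y else 0) := by
      intro S y
      have n1 := branchWeight_nonneg m hp hq l V Q₀ S y
      have n2 : (0 : ℝ) ≤ if S = ∅ ∧ y ∈ Q₁ then (1 : ℝ) else 0 := by split_ifs <;> simp
      have n3 : 0 ≤ if (T.vars ∩ S).Nonempty then p ^ #(T.vars ∩ S) * w *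
              branchWeight m p q l (V ∪ T.vars) (Q' (T.vars ∩ S)) (S \ T.vars) y else 0 := by
        have := branchWeight_nonneg m hp hq l (V ∪ T.vars) (Q' (T.vars ∩ S)) (S \ T.vars) y
        split_ifs <;> positivity
      by_cases hfull : queried (T :: l) S y = S ∧ ∀ z : Cube n, (∀ i ∉ S, z i = y i) → z ∈ Q
      swap
      · have : branchWeight m p q (T :: l) V Q S y = 0 := if_neg hfull
        linarith
      obtain ⟨hqu, hQ⟩ := hfull
      have e0 : branchWeight m p q (T :: l) V Q S y = p ^ #S * q ^ wide m (T :: l) V S y :=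
        if_pos ⟨hqu, hQ⟩
      by_cases hT : T.SatOff S y
      · by_cases hd : Disjoint T.vars S
        · have hS : S = ∅ := by rw [← hqu, queried, if_pos hT, if_pos hd]
          have hy : y ∈ Q₁ := mem_filter.2 ⟨hQ y fun _ _ => rfl, hT.sat hd⟩
          have : branchWeight m p q (T :: l) V Q S y = 1 := by
            rw [e0, wide, if_pos hT, if_pos hd, hS]
            simp
          rw [if_pos ⟨hS, hy⟩]
          linarith
        · have hne : (T.vars ∩ S).Nonempty := not_disjoint_iff_nonempty_inter.1 hd
          rw [queried, if_pos hT, if_neg hd] at hqu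
          have hqu' : queried l (S \ T.vars) y = S \ T.vars := by
            refine (queried_subset _ _ _).antisymm fun i hi => ?_
            have hi' := mem_sdiff.1 hi
            have := hqu.symm ▸ hi'.1
            rcases mem_union.1 this with h | h
            · exact absurd (mem_inter.1 h).1 hi'.2
            · exact h
          have hQ' : ∀ z : Cube n, (∀ i ∉ S \ T.vars, z i = y i) → z ∈ Q' (T.vars ∩ S) := by
            intro z hz
            refine mem_filter.2 ⟨mem_univ _, mem_filter.2 ⟨hQ _ fun i hi => ?_, fun x hx => ?_⟩⟩
            · rw [if_neg (fun h => hi (mem_inter.1 h).2)]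
              exact hz i fun h => hi (mem_sdiff.1 h).1
            · by_cases hxS : x.1 ∈ S
              · simp only [mem_inter, T.mem_vars hx, hxS, and_self, if_true]
                exact hc x hx
              · simp only [mem_inter, hxS, and_false, if_false]
                rw [hz _ (fun h => hxS (mem_sdiff.1 h).1)]
                exact hT x hx hxS
          have e1 : branchWeight m p q l (V ∪ T.vars) (Q' (T.vars ∩ S)) (S \ T.vars) y
              = p ^ #(S \ T.vars) * q ^ wide m l (V ∪ T.vars) (S \ T.vars) y :=
            if_pos ⟨hqu', hQ'⟩
          have hcard : #S = #(T.vars ∩ S) + #(S \ T.vars) := by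
            rw [inter_comm, card_inter_add_card_sdiff]
          have : branchWeight m p q (T :: l) V Q S y = p ^ #(T.vars ∩ S) * w *
              branchWeight m p q l (V ∪ T.vars) (Q' (T.vars ∩ S)) (S \ T.vars) y := by
            rw [e0, e1, wide, if_pos hT, if_neg hd, hcard, hw, pow_add, pow_add]
            ring
          rw [if_pos hne]
          linarith
      · have hqu' : queried l S y = S := by rwa [queried, if_neg hT] at hqu
        have hQ' : ∀ z : Cube n, (∀ i ∉ S, z i = y i) → z ∈ Q₀ := fun z hz =>
          mem_filter.2 ⟨hQ z hz, fun hs => hT fun x hx hxS => (hz _ hxS).symm.trans (hs x hx)⟩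
        have : branchWeight m p q (T :: l) V Q S y = branchWeight m p q l V Q₀ S y := by
          rw [e0, wide, if_neg hT]
          exact (if_pos ⟨hqu', hQ'⟩).symm
        linarith
    have hG : ∑ S ∈ Vᶜ.powerset, ∑ y, (if (T.vars ∩ S).Nonempty then p ^ #(T.vars ∩ S) * w *
              branchWeight m p q l (V ∪ T.vars) (Q' (T.vars ∩ S)) (S \ T.vars) y else 0)
        = ∑ S ∈ Vᶜ.powerset, G (T.vars ∩ S) (S \ T.vars) := by
      refine Finset.sum_congr rfl fun S _ => ?_
      simp only [G]
      split_ifs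
      · rw [Finset.mul_sum]
      · simp
    have hGA : ∀ A, ∑ S ∈ (V ∪ T.vars)ᶜ.powerset, G A S
        ≤ (if A.Nonempty then (2 * p) ^ #A else 0) * (w * (2 * #Q₁)) := by
      intro A
      simp only [G]
      split_ifs with hA
      · rw [← Finset.mul_sum]
        have h1 := ih hl hlW (V ∪ T.vars) (Q' A)
        have h2 : (#(Q' A) : ℝ) ≤ 2 ^ #A * #Q₁ := by exact_mod_cast card_overwrite_le A c Q₁
        calc p ^ #A * w * _ ≤ p ^ #A * w * (2 * (2 ^ #A * #Q₁)) := by gcongr; linarith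
          _ = _ := by rw [mul_pow]; ring
      · simp
    have hsumA : ∑ A ∈ (T.vars \ V).powerset, (if A.Nonempty then (2 * p) ^ #A else 0)
        = (1 + 2 * p) ^ #(T.vars \ V) - 1 := by
      rw [← sum_powerset_pow_card, eq_sub_iff_add_eq,
        ← Finset.sum_erase_add _ _ (empty_mem_powerset (T.vars \ V)),
        ← Finset.sum_erase_add _ (fun A => (2 * p) ^ #A) (empty_mem_powerset (T.vars \ V))]
      simp only [Finset.not_nonempty_empty, if_false, add_zero, card_empty, pow_zero]
      congr 1
      refine Finset.sum_congr rfl fun A hA => ?_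
      rw [if_pos (nonempty_iff_ne_empty.2 (mem_erase.1 hA).1)]
    have hlast : ∑ S ∈ Vᶜ.powerset, G (T.vars ∩ S) (S \ T.vars) ≤ #Q₁ := by
      rw [sum_powerset_compl_split V T.vars G]
      refine (Finset.sum_le_sum fun A _ => hGA A).trans ?_
      rw [← Finset.sum_mul, hsumA]
      have := hpq #(T.vars \ V) ((card_le_card sdiff_subset).trans (hW T List.mem_cons_self))
      calc ((1 + 2 * p) ^ #(T.vars \ V) - 1) * (w * (2 * #Q₁))
          = (w * ((1 + 2 * p) ^ #(T.vars \ V) - 1)) * (2 * #Q₁) := by ring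
        _ ≤ 1 / 2 * (2 * #Q₁) := by gcongr
        _ = #Q₁ := by ring
    have hcardQ : (#Q₁ : ℝ) + #Q₀ = #Q := by
      exact_mod_cast Finset.card_filter_add_card_filter_not (s := Q) (fun z => T.Sat z)
    calc ∑ S ∈ Vᶜ.powerset, ∑ y, branchWeight m p q (T :: l) V Q S y
        ≤ ∑ S ∈ Vᶜ.powerset, ∑ y, (branchWeight m p q l V Q₀ S y
          + (if S = ∅ ∧ y ∈ Q₁ then (1 : ℝ) else 0)
          + (if (T.vars ∩ S).Nonempty then p ^ #(T.vars ∩ S) * w *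
              branchWeight m p q l (V ∪ T.vars) (Q' (T.vars ∩ S)) (S \ T.vars) y else 0)) :=
          Finset.sum_le_sum fun S _ => Finset.sum_le_sum fun y _ => hpoint S y
      _ ≤ 2 * #Q₀ + #Q₁ + #Q₁ := by
          simp_rw [Finset.sum_add_distrib]
          rw [hG, sum_ite_empty_mem]
          have := ih hl hlW V Q₀
          linarith
      _ = 2 * #Q := by linarith

open Classical in
/-- The fraction of the points at which the canonical decision tree with free set `S` queries all
of `S`, each weighted by `q` to the number of variables in wide terms. -/
lemma sum_full_branches_le {n : ℕ} (m W : ℕ) {p q : ℝ} (hp : 0 ≤ p) (hq : 0 ≤ q)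
    (hpq : ∀ t ≤ W, q ^ wideCost m t * ((1 + 2 * p) ^ t - 1) ≤ 1 / 2)
    (l : List (Term n)) (hsat : ∀ T ∈ l, ∃ y, T.Sat y) (hW : ∀ T ∈ l, #T.vars ≤ W) :
    ∑ S, p ^ #S * ((∑ y, if queried l S y = S then q ^ wide m l ∅ S y else 0) / 2 ^ n) ≤ 2 := by
  have h := sum_branchWeight_le m W hp hq hpq l hsat hW ∅ univ
  have hu : (#(univ : Finset (Cube n)) : ℝ) = 2 ^ n := by simp
  rw [hu, compl_empty, powerset_univ] at h
  have : ∀ S : Finset (Fin n), ∑ y, branchWeight m p q l ∅ univ S y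
      = p ^ #S * ∑ y, if queried l S y = S then q ^ wide m l ∅ S y else 0 := fun S => by
    rw [Finset.mul_sum]
    refine Finset.sum_congr rfl fun y _ => ?_
    simp [branchWeight]
  simp_rw [this] at h
  simp_rw [← mul_div_assoc]
  rw [← Finset.sum_div, div_le_iff₀ (by positivity)]
  exact h

/-! ### Full branches with many variables in wide terms -/

/-- The wide terms visited by the canonical decision tree all meet `R` and are satisfied off `R`,
and they have many variables in total. -/
lemma exists_wide_terms {n : ℕ} (m : ℕ) (l : List (Term n)) (V R : Finset (Fin n)) (y : Cube n) :
    ∃ U ⊆ l.toFinset.filter fun T => ¬ Disjoint T.vars R,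
      (∀ T ∈ U, T.SatOff R y) ∧ wide m l V R y ≤ #(U.biUnion Term.vars \ V) ∧
        m * #U ≤ #(U.biUnion Term.vars \ V) := by
  induction l generalizing V R with
  | nil => exact ⟨∅, empty_subset _, by simp, by simp [wide], by simp⟩
  | cons T l ih =>
    have hl : ∀ R' ⊆ R, (l.toFinset.filter fun T => ¬ Disjoint T.vars R')
        ⊆ (T :: l).toFinset.filter fun T => ¬ Disjoint T.vars R := fun R' hR' T' hT' => by
      rw [mem_filter, List.mem_toFinset] at hT' ⊢
      exact ⟨List.mem_cons_of_mem _ hT'.1, fun h => hT'.2 (h.mono_right hR')⟩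
    by_cases hT : T.SatOff R y
    · by_cases hd : Disjoint T.vars R
      · exact ⟨∅, empty_subset _, by simp, by simp [wide, hT, hd], by simp⟩
      · obtain ⟨U, hU, hsat, hwide, hcard⟩ := ih (V ∪ T.vars) (R \ T.vars)
        have hsub := hU.trans (hl _ sdiff_subset)
        have hsat' : ∀ T ∈ U, T.SatOff R y := fun T' h => (hsat T' h).mono sdiff_subset
        have hw : wide m (T :: l) V R y
            = wideCost m #(T.vars \ V) + wide m l (V ∪ T.vars) (R \ T.vars) y := by
          rw [wide, if_pos hT, if_neg hd]
        by_cases hm : m ≤ #(T.vars \ V)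
        · have hnew : #((insert T U).biUnion Term.vars \ V)
              = #(T.vars \ V) + #(U.biUnion Term.vars \ (V ∪ T.vars)) := by
            rw [← card_union_of_disjoint]
            · congr 1
              ext i
              simp only [biUnion_insert, mem_sdiff, mem_union]
              tauto
            · refine disjoint_left.2 fun i hi hi' => ?_
              simp only [mem_sdiff, mem_union] at hi hi'
              tauto
          refine ⟨insert T U, insert_subset ?_ hsub, ?_, ?_, ?_⟩
          · simp [hd]
          · simpa [hT] using hsat'
          · rw [hw, hnew, wideCost, if_pos hm]
            omega
          · rw [hnew]
            have := card_insert_le T U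
            nlinarith
        · have hle : #(U.biUnion Term.vars \ (V ∪ T.vars)) ≤ #(U.biUnion Term.vars \ V) :=
            card_le_card (sdiff_subset_sdiff le_rfl subset_union_left)
          refine ⟨U, hsub, hsat', ?_, hcard.trans hle⟩
          rw [hw, wideCost, if_neg hm, zero_add]
          exact hwide.trans hle
    · obtain ⟨U, hU, hsat, hwide, hcard⟩ := ih V R
      refine ⟨U, hU.trans (hl R subset_rfl), hsat, ?_, hcard⟩
      rwa [wide, if_neg hT]

open Classical in
/-- A family of terms is satisfied off `S` with probability at most `2 ^ (#S - v)`, where `v` is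
the number of variables of the family. -/
lemma card_satOff_mul_le {n : ℕ} (U : Finset (Term n)) (S : Finset (Fin n)) :
    #{y : Cube n | ∀ T ∈ U, T.SatOff S y} * 2 ^ #(U.biUnion Term.vars) ≤ 2 ^ (n + #S) := by
  set A := U.biUnion Term.vars \ S with hA
  have hle : #(U.biUnion Term.vars) ≤ #A + #S := by
    exact card_le_card_sdiff_add_card
  have hAn : #A ≤ n := by simpa using card_le_univ A
  have hcard : #{y : Cube n | ∀ T ∈ U, T.SatOff S y} ≤ 2 ^ (n - #A) := by
    rcases ({y : Cube n | ∀ T ∈ U, T.SatOff S y} : Finset (Cube n)).eq_empty_or_nonempty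
      with h | ⟨c, hc⟩
    · simp [h]
    · have : n - #A = #Aᶜ := by rw [card_compl, Fintype.card_fin]
      rw [this, ← card_agree_off Aᶜ c]
      refine card_le_card fun y hy => ?_
      simp only [mem_filter, mem_univ, true_and, mem_compl, not_not] at hy hc ⊢
      intro i hi
      rw [hA, mem_sdiff, mem_biUnion] at hi
      obtain ⟨⟨T, hT, hiT⟩, hiS⟩ := hi
      obtain ⟨x, hx, rfl⟩ := mem_image.1 hiT
      rw [hy T hT x hx hiS, hc T hT x hx hiS]
  calc _ ≤ 2 ^ (n - #A) * 2 ^ (#A + #S) := by gcongr; norm_num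
    _ = 2 ^ (n + #S) := by rw [← pow_add]; congr 1; omega

open Classical in
/-- If every variable occurs in at most `k` terms, then for a fixed free set `S` branches through
wide terms are unlikely: the at most `k * #S` terms meeting `S` are the only candidates, and each
wide one is alive with probability at most `1 / k`, even after weighting by `(3 / 2) ^ wide`. -/
lemma sum_pow_wide_le {n k m : ℕ} (l : List (Term n))
    (hread : ∀ i, #(l.toFinset.filter fun T => i ∈ T.vars) ≤ k) (hm : (k : ℝ) * (3 / 4) ^ m ≤ 1)
    (S : Finset (Fin n)) :
    (∑ y, (3 / 2 : ℝ) ^ wide m l ∅ S y) / 2 ^ n ≤ 6 ^ #S := by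
  set X := l.toFinset.filter fun T => ¬ Disjoint T.vars S with hX
  have hXcard : #X ≤ k * #S := by
    have : X ⊆ S.biUnion fun i => l.toFinset.filter fun T => i ∈ T.vars := fun T hT => by
      rw [hX, mem_filter] at hT
      obtain ⟨i, hi, hi'⟩ := not_disjoint_iff.1 hT.2
      exact mem_biUnion.2 ⟨i, hi', mem_filter.2 ⟨hT.1, hi⟩⟩
    refine (card_le_card this).trans ?_
    rw [mul_comm]
    exact card_biUnion_le_card_mul _ _ _ fun i _ => hread i
  have hpoint : ∀ y, (3 / 2 : ℝ) ^ wide m l ∅ S y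
      ≤ ∑ U ∈ X.powerset, if (∀ T ∈ U, T.SatOff S y) ∧ m * #U ≤ #(U.biUnion Term.vars) then
          (3 / 2 : ℝ) ^ #(U.biUnion Term.vars) else 0 := fun y => by
    obtain ⟨U, hU, hsat, hwide, hcard⟩ := exists_wide_terms m l ∅ S y
    rw [sdiff_empty] at hwide hcard
    calc (3 / 2 : ℝ) ^ wide m l ∅ S y ≤ (3 / 2 : ℝ) ^ #(U.biUnion Term.vars) := by
          gcongr
          norm_num
      _ = if (∀ T ∈ U, T.SatOff S y) ∧ m * #U ≤ #(U.biUnion Term.vars) then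
          (3 / 2 : ℝ) ^ #(U.biUnion Term.vars) else 0 := (if_pos ⟨hsat, hcard⟩).symm
      _ ≤ _ := Finset.single_le_sum (f := fun U => if (∀ T ∈ U, T.SatOff S y) ∧
            m * #U ≤ #(U.biUnion Term.vars) then (3 / 2 : ℝ) ^ #(U.biUnion Term.vars) else 0)
            (fun U _ => by positivity) (mem_powerset.2 hU)
  have hU : ∀ U : Finset (Term n),
      (∑ y : Cube n, if (∀ T ∈ U, T.SatOff S y) ∧ m * #U ≤ #(U.biUnion Term.vars) then
          (3 / 2 : ℝ) ^ #(U.biUnion Term.vars) else 0) ≤ 2 ^ (n + #S) * ((3 / 4) ^ m) ^ #U := by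
    intro U
    by_cases hc : m * #U ≤ #(U.biUnion Term.vars)
    · simp only [hc, and_true]
      rw [← Finset.sum_filter, Finset.sum_const, nsmul_eq_mul, ← pow_mul]
      have h1 : (#{y : Cube n | ∀ T ∈ U, T.SatOff S y} : ℝ) * 2 ^ #(U.biUnion Term.vars)
          ≤ 2 ^ (n + #S) := by exact_mod_cast card_satOff_mul_le U S
      calc (#{y : Cube n | ∀ T ∈ U, T.SatOff S y} : ℝ) * (3 / 2) ^ #(U.biUnion Term.vars)
          = (#{y : Cube n | ∀ T ∈ U, T.SatOff S y} : ℝ) * 2 ^ #(U.biUnion Term.vars)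
              * (3 / 4) ^ #(U.biUnion Term.vars) := by
            rw [mul_assoc, ← mul_pow]
            norm_num
        _ ≤ 2 ^ (n + #S) * (3 / 4) ^ (m * #U) :=
            mul_le_mul h1 (pow_le_pow_of_le_one (by norm_num) (by norm_num) hc) (by positivity)
              (by positivity)
    · simp only [hc, and_false, if_false, Finset.sum_const_zero]
      positivity
  have hexp : (1 + (3 / 4 : ℝ) ^ m) ^ (k * #S) ≤ 3 ^ #S := by
    rw [pow_mul]
    gcongr
    calc (1 + (3 / 4 : ℝ) ^ m) ^ k ≤ Real.exp ((3 / 4 : ℝ) ^ m) ^ k := by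
          gcongr
          linarith [Real.add_one_le_exp ((3 / 4 : ℝ) ^ m)]
      _ = Real.exp (k * (3 / 4 : ℝ) ^ m) := (Real.exp_nat_mul _ _).symm
      _ ≤ Real.exp 1 := Real.exp_le_exp.2 hm
      _ ≤ 3 := Real.exp_one_lt_d9.le.trans (by norm_num)
  rw [div_le_iff₀ (by positivity)]
  calc ∑ y, (3 / 2 : ℝ) ^ wide m l ∅ S y
      ≤ ∑ y, ∑ U ∈ X.powerset, (if (∀ T ∈ U, T.SatOff S y) ∧ m * #U ≤ #(U.biUnion Term.vars) then
          (3 / 2 : ℝ) ^ #(U.biUnion Term.vars) else 0) := Finset.sum_le_sum fun y _ => hpoint y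
    _ ≤ ∑ U ∈ X.powerset, 2 ^ (n + #S) * ((3 / 4 : ℝ) ^ m) ^ #U := by
        rw [Finset.sum_comm]
        exact Finset.sum_le_sum fun U _ => hU U
    _ = 2 ^ (n + #S) * (1 + (3 / 4 : ℝ) ^ m) ^ #X := by
        rw [← Finset.mul_sum, sum_powerset_pow_card]
    _ ≤ 2 ^ (n + #S) * (1 + (3 / 4 : ℝ) ^ m) ^ (k * #S) := by
        gcongr
        linarith [pow_nonneg (by norm_num : (0 : ℝ) ≤ 3 / 4) m]
    _ ≤ 2 ^ (n + #S) * 3 ^ #S := by gcongr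
    _ = 6 ^ #S * 2 ^ n := by
        rw [show (6 : ℝ) = 2 * 3 by norm_num, mul_pow]
        ring

/-! ### Concentration on low degrees -/

/-- The probability that a random subset of `Fin n`, containing each element independently with
probability `p`, is equal to `R`. -/
noncomputable def subsetProb {n : ℕ} (p : ℝ) (R : Finset (Fin n)) : ℝ :=
  (∏ _i ∈ R, p) * ∏ _i ∈ univ \ R, (1 - p)

lemma subsetProb_nonneg {n : ℕ} {p : ℝ} (hp : 0 ≤ p) (hp1 : p ≤ 1) (R : Finset (Fin n)) :
    0 ≤ subsetProb p R := by
  have : 0 ≤ 1 - p := by linarith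
  unfold subsetProb
  simp only [prod_const]
  positivity

lemma sum_subsetProb_mul_prod {n : ℕ} (p : ℝ) (a b : Fin n → ℝ) :
    ∑ R, subsetProb p R * ((∏ i ∈ R, a i) * ∏ i ∈ univ \ R, b i)
      = ∏ i, (p * a i + (1 - p) * b i) := by
  rw [Finset.prod_add, powerset_univ]
  refine Finset.sum_congr rfl fun R _ => ?_
  rw [Finset.prod_mul_distrib, Finset.prod_mul_distrib, subsetProb]
  ring

lemma sum_subsetProb {n : ℕ} (p : ℝ) : ∑ R : Finset (Fin n), subsetProb p R = 1 := by
  have := sum_subsetProb_mul_prod (n := n) p (fun _ => 1) (fun _ => 1)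
  simpa using this

lemma sum_subsetProb_superset {n : ℕ} (p : ℝ) (S : Finset (Fin n)) :
    ∑ R, (if S ⊆ R then subsetProb p R else 0) = p ^ #S := by
  have h := sum_subsetProb_mul_prod p (fun _ => 1) (fun i => if i ∈ S then 0 else 1)
  have h2 : ∏ i, (p * 1 + (1 - p) * (if i ∈ S then 0 else 1)) = p ^ #S := by
    rw [← Finset.prod_const, ← Finset.prod_subset (subset_univ S)]
    · exact Finset.prod_congr rfl fun i hi => by simp [hi]
    · intro i _ hi
      simp [hi]
  rw [← h2, ← h]
  refine Finset.sum_congr rfl fun R _ => ?_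
  split_ifs with hS
  · rw [Finset.prod_eq_one (s := univ \ R)]
    · simp
    · intro i hi
      rw [if_neg fun h => (mem_sdiff.1 hi).2 (hS h)]
  · obtain ⟨i, hi, hi'⟩ := not_subset.1 hS
    rw [Finset.prod_eq_zero (s := univ \ R) (i := i)]
    · simp
    · simp [hi']
    · simp [hi]

lemma sum_subsetProb_half_pow {n : ℕ} (p : ℝ) (S : Finset (Fin n)) :
    ∑ R, subsetProb p R * (1 / 2) ^ #(S ∩ R) = (1 - p / 2) ^ #S := by
  have h := sum_subsetProb_mul_prod p (fun i => if i ∈ S then 1 / 2 else 1) (fun _ => 1)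
  have h2 : ∏ i, (p * (if i ∈ S then 1 / 2 else 1) + (1 - p) * 1) = (1 - p / 2) ^ #S := by
    rw [← Finset.prod_const, ← Finset.prod_subset (subset_univ S)]
    · exact Finset.prod_congr rfl fun i hi => by
        rw [if_pos hi]
        ring
    · intro i _ hi
      simp [hi]
  rw [← h2, ← h]
  refine Finset.sum_congr rfl fun R _ => ?_
  rw [Finset.prod_const_one, mul_one, ← Finset.prod_filter, Finset.prod_const, inter_comm,
    filter_mem_eq_inter]

/-- A large set probably has at least `t` elements in a random subset. -/
lemma half_le_sum_subsetProb {n t : ℕ} {p : ℝ} (hp : 0 ≤ p) (hp1 : p ≤ 1) (S : Finset (Fin n))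
    (hS : (2 : ℝ) ^ t * (1 - p / 2) ^ #S ≤ 1 / 2) :
    1 / 2 ≤ ∑ R, if t ≤ #(S ∩ R) then subsetProb p R else 0 := by
  have hpt : ∀ R, subsetProb p R - 2 ^ t * (subsetProb p R * (1 / 2) ^ #(S ∩ R))
      ≤ if t ≤ #(S ∩ R) then subsetProb p R else 0 := fun R => by
    have h0 := subsetProb_nonneg hp hp1 R
    split_ifs with h
    · have : 0 ≤ (2 : ℝ) ^ t * (subsetProb p R * (1 / 2) ^ #(S ∩ R)) := by positivity
      linarith
    · have h1 : (1 : ℝ) ≤ 2 ^ t * (1 / 2) ^ #(S ∩ R) := by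
        rw [one_div, inv_pow, ← div_eq_mul_inv, one_le_div (by positivity)]
        exact pow_le_pow_right₀ (by norm_num) (not_le.1 h).le
      nlinarith
  have := Finset.sum_le_sum fun R (_ : R ∈ univ) => hpt R
  rw [Finset.sum_sub_distrib, ← Finset.mul_sum, sum_subsetProb, sum_subsetProb_half_pow] at this
  linarith

open Classical in
/-- With free set `R`, the Fourier weight at the sets with at least `t` elements in `R` is carried
by the branches with at least `t` queries. -/
lemma sum_fourierCoef_sq_inter_le {n : ℕ} (l : List (Term n)) (R : Finset (Fin n)) (t : ℕ) :
    ∑ S, (if t ≤ #(S ∩ R) then fourierCoef (listFun l) S ^ 2 else 0)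
      ≤ (∑ y, if t ≤ #(queried l R y) then 1 else 0) / 2 ^ n := by
  set h : Cube n → ℝ := fun y => if t ≤ #(queried l R y) then listFun l y else 0 with hh
  calc _ ≤ ∑ S, fourierCoef h S ^ 2 := by
        refine Finset.sum_le_sum fun S _ => ?_
        split_ifs with hS
        · rw [fourierCoef_eq_of_long_branches l R S t hS]
        · positivity
    _ = (∑ y, h y ^ 2) / 2 ^ n := sum_fourierCoef_sq h
    _ ≤ _ := by
        gcongr with y
        simp only [hh]
        split_ifs
        · exact listFun_sq_le_one l y
        · simp

open Classical in
/-- The Fourier weight at degrees `≥ N` is at most `2 ^ (2 - t)`. If `R` is a random set of free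
variables, a set `S` of size at least `N` probably has at least `t` elements in `R`, while at least
`t` variables are queried with probability at most `2 ^ (1 - t)`, by the switching lemma. -/
lemma sum_fourierCoef_sq_high_le {n W : ℕ} {p : ℝ} (hp : 0 ≤ p) (hp1 : p ≤ 1)
    (hpW : ∀ t ≤ W, (1 + 4 * p) ^ t - 1 ≤ 1 / 2) (l : List (Term n))
    (hsat : ∀ T ∈ l, ∃ y, T.Sat y) (hW : ∀ T ∈ l, #T.vars ≤ W) (t N : ℕ)
    (hN : (2 : ℝ) ^ t * (1 - p / 2) ^ N ≤ 1 / 2) :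
    ∑ S with N ≤ #S, fourierCoef (listFun l) S ^ 2 ≤ 4 / 2 ^ t := by
  have hsw := sum_full_branches_le 0 W (p := 2 * p) (q := 1) (by linarith) zero_le_one
    (fun t ht => by
      rw [one_pow, one_mul, ← mul_assoc]
      norm_num1
      exact hpW t ht) l hsat hW
  simp only [one_pow] at hsw
  have hlow : ∑ S with N ≤ #S, fourierCoef (listFun l) S ^ 2
      ≤ 2 * ∑ R, subsetProb p R *
        ∑ S, (if t ≤ #(S ∩ R) then fourierCoef (listFun l) S ^ 2 else 0) := by
    simp_rw [Finset.mul_sum]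
    rw [Finset.sum_comm, Finset.sum_filter]
    refine Finset.sum_le_sum fun S _ => ?_
    have hpos : ∀ R : Finset (Fin n), 0 ≤ subsetProb p R := subsetProb_nonneg hp hp1
    split_ifs with hS
    · have h1 : (2 : ℝ) ^ t * (1 - p / 2) ^ #S ≤ 1 / 2 := by
        refine le_trans ?_ hN
        gcongr ?_ * ?_
        exact pow_le_pow_of_le_one (by linarith) (by linarith) hS
      have h2 := half_le_sum_subsetProb hp hp1 S h1
      calc fourierCoef (listFun l) S ^ 2
          ≤ 2 * (∑ R, if t ≤ #(S ∩ R) then subsetProb p R else 0)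
              * fourierCoef (listFun l) S ^ 2 := by nlinarith [sq_nonneg (fourierCoef (listFun l) S)]
        _ = _ := by
            rw [mul_assoc, Finset.sum_mul, Finset.mul_sum]
            refine Finset.sum_congr rfl fun R _ => ?_
            split_ifs <;> ring
    · refine Finset.sum_nonneg fun R _ => ?_
      have := hpos R
      split_ifs <;> positivity
  have hmid : ∀ y : Cube n, ∑ R, subsetProb p R * (if t ≤ #(queried l R y) then 1 else 0)
      ≤ ∑ S, (if t ≤ #S ∧ queried l S y = S then p ^ #S else 0) := fun y => by
    have hpt : ∀ R, subsetProb p R * (if t ≤ #(queried l R y) then 1 else 0)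
        ≤ ∑ S, if t ≤ #S ∧ queried l S y = S then (if S ⊆ R then subsetProb p R else 0) else 0 := by
      intro R
      have hR := subsetProb_nonneg hp hp1 R
      have hnn : ∀ S : Finset (Fin n), (0 : ℝ) ≤ if t ≤ #S ∧ queried l S y = S then
          (if S ⊆ R then subsetProb p R else 0) else 0 := fun S => by
        split_ifs <;> first | exact le_rfl | exact hR
      split_ifs with h
      · refine le_trans (le_of_eq ?_) (Finset.single_le_sum (fun S _ => hnn S)
          (mem_univ (queried l R y)))
        rw [if_pos ⟨h, queried_queried l R y⟩, if_pos (queried_subset l R y), mul_one]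
      · rw [mul_zero]
        exact Finset.sum_nonneg fun S _ => hnn S
    refine (Finset.sum_le_sum fun R _ => hpt R).trans (le_of_eq ?_)
    rw [Finset.sum_comm]
    refine Finset.sum_congr rfl fun S _ => ?_
    split_ifs
    · exact sum_subsetProb_superset p S
    · simp
  have hhigh : ∑ R, subsetProb p R * ((∑ y, if t ≤ #(queried l R y) then 1 else 0) / 2 ^ n)
      ≤ 2 / 2 ^ t := by
    calc _ = (∑ y, ∑ R, subsetProb p R * (if t ≤ #(queried l R y) then 1 else 0)) / 2 ^ n := by
          rw [Finset.sum_comm, Finset.sum_div]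
          refine Finset.sum_congr rfl fun R _ => ?_
          rw [← Finset.mul_sum, mul_div_assoc]
      _ ≤ (∑ y, ∑ S, (if t ≤ #S ∧ queried l S y = S then p ^ #S else 0)) / 2 ^ n := by
          gcongr ?_ / _
          exact Finset.sum_le_sum fun y _ => hmid y
      _ ≤ (∑ y, ∑ S, (if queried l S y = S then (2 * p) ^ #S else 0) / 2 ^ t) / 2 ^ n := by
          gcongr with y _ S
          by_cases hS : t ≤ #S
          · by_cases hq : queried l S y = S
            · simp only [hS, hq, and_self, if_true]
              rw [le_div_iff₀ (by positivity), mul_pow, mul_comm]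
              gcongr
              norm_num
            · simp [hq]
          · simp only [hS, false_and, if_false]
            positivity
      _ = (∑ S, (2 * p) ^ #S * ((∑ y, if queried l S y = S then 1 else 0) / 2 ^ n)) / 2 ^ t := by
          rw [Finset.sum_comm, Finset.sum_div, Finset.sum_div]
          refine Finset.sum_congr rfl fun S _ => ?_
          rw [← Finset.sum_div, div_right_comm, ← mul_div_assoc, Finset.mul_sum]
          simp
      _ ≤ 2 / 2 ^ t := by gcongr
  calc _ ≤ _ := hlow
    _ ≤ 2 * ∑ R, subsetProb p R * ((∑ y, if t ≤ #(queried l R y) then 1 else 0) / 2 ^ n) := by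
        gcongr with R
        · exact subsetProb_nonneg hp hp1 R
        · exact sum_fourierCoef_sq_inter_le l R t
    _ ≤ 2 * (2 / 2 ^ t) := by gcongr
    _ = 4 / 2 ^ t := by ring

/-! ### A small family carrying the Fourier weight -/

lemma exp_quarter_le : Real.exp (1 / 4) ≤ 3 / 2 := by
  refine le_of_pow_le_pow_left₀ (n := 4) (by norm_num) (by norm_num) ?_
  rw [← Real.exp_nat_mul]
  norm_num
  exact Real.exp_one_lt_d9.le.trans (by norm_num)

lemma one_add_pow_le {x : ℝ} {t : ℕ} (hx : 0 ≤ x) (h : t * x ≤ 1 / 4) : (1 + x) ^ t ≤ 3 / 2 :=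
  calc (1 + x) ^ t ≤ Real.exp x ^ t := by
        gcongr
        linarith [Real.add_one_le_exp x]
    _ = Real.exp (t * x) := (Real.exp_nat_mul _ _).symm
    _ ≤ Real.exp (1 / 4) := Real.exp_le_exp.2 h
    _ ≤ 3 / 2 := exp_quarter_le

lemma wideCost_weight_le {m : ℕ} (hm : 7 ≤ m) (t : ℕ) :
    (4 / 5 : ℝ) ^ wideCost m t * ((1 + 2 * (1 / (8 * m))) ^ t - 1) ≤ 1 / 2 := by
  have hm' : (7 : ℝ) ≤ m := by exact_mod_cast hm
  have hx : (2 * (1 / (8 * m)) : ℝ) = 1 / (4 * m) := by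
    field_simp
    norm_num
  rw [hx]
  unfold wideCost
  split_ifs with h
  · have h1 : (4 / 5 : ℝ) * (1 + 1 / (4 * m)) ≤ 9 / 10 := by
      have : (1 / (4 * m) : ℝ) ≤ 1 / 28 := one_div_le_one_div_of_le (by norm_num) (by linarith)
      linarith
    calc (4 / 5 : ℝ) ^ t * ((1 + 1 / (4 * m)) ^ t - 1)
        ≤ (4 / 5 : ℝ) ^ t * (1 + 1 / (4 * m)) ^ t := by
          gcongr
          linarith
      _ = (4 / 5 * (1 + 1 / (4 * m))) ^ t := (mul_pow _ _ _).symm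
      _ ≤ (9 / 10) ^ t := by gcongr
      _ ≤ (9 / 10) ^ 7 := pow_le_pow_of_le_one (by norm_num) (by norm_num) (hm.trans h)
      _ ≤ 1 / 2 := by norm_num
  · have h1 : (t : ℝ) * (1 / (4 * m)) ≤ 1 / 4 := by
      have : (t : ℝ) ≤ m := by exact_mod_cast (not_le.1 h).le
      rw [mul_one_div, div_le_div_iff₀ (by positivity) (by norm_num)]
      linarith
    have := one_add_pow_le (by positivity) h1
    rw [pow_zero, one_mul]
    linarith

open Classical in
/-- A Fourier coefficient is bounded by the fraction of the full branches. The fraction of those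
with fewer than `v₀` variables in wide terms is bounded by the weight of the switching lemma; for
the others, the weight is combined with the bound for a fixed set by the Cauchy–Schwarz
inequality. -/
lemma exists_branch_bounds {n k m : ℕ} (hkm : (k : ℝ) * (3 / 4) ^ m ≤ 1)
    (l : List (Term n)) (hread : ∀ i, #(l.toFinset.filter fun T => i ∈ T.vars) ≤ k) (v₀ : ℕ)
    (S : Finset (Fin n)) :
    ∃ a b : ℝ, |fourierCoef (listFun l) S| ≤ a + b ∧ 0 ≤ a ∧ 0 ≤ b ∧
      a ≤ (5 / 4) ^ v₀ *
        ((∑ y, if queried l S y = S then (4 / 5 : ℝ) ^ wide m l ∅ S y else 0) / 2 ^ n) ∧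
      b ^ 2 ≤ 6 ^ #S * ((5 / 6) ^ v₀ *
        ((∑ y, if queried l S y = S then (4 / 5 : ℝ) ^ wide m l ∅ S y else 0) / 2 ^ n)) := by
  refine ⟨(∑ y, if queried l S y = S ∧ wide m l ∅ S y < v₀ then 1 else 0) / 2 ^ n,
    (∑ y, if queried l S y = S ∧ v₀ ≤ wide m l ∅ S y then 1 else 0) / 2 ^ n, ?_,
    by positivity, by positivity, ?_, ?_⟩
  · rw [fourierCoef_eq_of_long_branches l S S #S (by rw [inter_self]), fourierCoef, abs_div,
      abs_of_pos (by positivity : (0 : ℝ) < 2 ^ n), ← add_div, ← Finset.sum_add_distrib]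
    gcongr
    refine (Finset.abs_sum_le_sum_abs _ _).trans (Finset.sum_le_sum fun y _ => ?_)
    rw [abs_mul, abs_monomialAt, mul_one]
    by_cases hc : #S ≤ #(queried l S y)
    · have hq : queried l S y = S := eq_of_subset_of_card_le (queried_subset l S y) hc
      rw [if_pos hc]
      refine (abs_listFun_le_one l y).trans (le_of_eq ?_)
      by_cases hw : wide m l ∅ S y < v₀
      · simp [hq, hw]
      · simp [hq, hw, not_lt.1 hw]
    · rw [if_neg hc, abs_zero]
      positivity
  · rw [← mul_div_assoc, Finset.mul_sum]
    gcongr with y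
    by_cases hq : queried l S y = S
    · by_cases hw : wide m l ∅ S y < v₀
      · simp only [hq, hw, and_self, if_true]
        calc (1 : ℝ) = (5 / 4) ^ v₀ * (4 / 5) ^ v₀ := by rw [← mul_pow]; norm_num
          _ ≤ _ := by
            gcongr ?_ * ?_
            exact pow_le_pow_of_le_one (by norm_num) (by norm_num) hw.le
      · simp only [hw, and_false, if_false]
        positivity
    · simp [hq]
  · have hcs : (∑ y, if queried l S y = S ∧ v₀ ≤ wide m l ∅ S y then (1 : ℝ) else 0) ^ 2
        ≤ (∑ y, (3 / 2 : ℝ) ^ wide m l ∅ S y) *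
          ∑ y, if queried l S y = S ∧ v₀ ≤ wide m l ∅ S y then
            (2 / 3 : ℝ) ^ wide m l ∅ S y else 0 := by
      refine Finset.sum_sq_le_sum_mul_sum_of_sq_le_mul _ (fun _ _ => by positivity)
        (fun _ _ => by positivity) fun y _ => ?_
      split_ifs
      · rw [← mul_pow]
        exact le_of_eq (by norm_num)
      · simp
    have h2 : (∑ y, if queried l S y = S ∧ v₀ ≤ wide m l ∅ S y then
            (2 / 3 : ℝ) ^ wide m l ∅ S y else 0)
        ≤ (5 / 6) ^ v₀ * ∑ y, if queried l S y = S then (4 / 5 : ℝ) ^ wide m l ∅ S y else 0 := by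
      rw [Finset.mul_sum]
      gcongr with y
      by_cases hq : queried l S y = S
      · by_cases hw : v₀ ≤ wide m l ∅ S y
        · simp only [hq, hw, and_self, if_true]
          calc (2 / 3 : ℝ) ^ wide m l ∅ S y
              = (5 / 6) ^ wide m l ∅ S y * (4 / 5) ^ wide m l ∅ S y := by
                rw [← mul_pow]
                norm_num
            _ ≤ _ := by
              gcongr ?_ * _
              exact pow_le_pow_of_le_one (by norm_num) (by norm_num) hw
        · simp only [hw, and_false, if_false]
          positivity
      · simp [hq]
    have h3 := sum_pow_wide_le l hread hkm S
    rw [div_pow, div_le_iff₀ (by positivity)]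
    rw [div_le_iff₀ (by positivity)] at h3
    calc _ ≤ _ := hcs
      _ ≤ (6 ^ #S * 2 ^ n) * ((5 / 6) ^ v₀ *
            ∑ y, if queried l S y = S then (4 / 5 : ℝ) ^ wide m l ∅ S y else 0) := by
          gcongr
      _ = _ := by field_simp

/-- The family consists of the sets of size `< N` at which the branches with fewer than `v₀`
variables in wide terms have total weight at least `τ`. -/
lemma exists_family {n k m W : ℕ} (hm : 7 ≤ m) (hkm : (k : ℝ) * (3 / 4) ^ m ≤ 1)
    (l : List (Term n)) (hsat : ∀ T ∈ l, ∃ y, T.Sat y) (hW : ∀ T ∈ l, #T.vars ≤ W)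
    (hread : ∀ i, #(l.toFinset.filter fun T => i ∈ T.vars) ≤ k) (v₀ N : ℕ) {τ δ : ℝ} (hτ : 0 < τ)
    (hδ : ∑ S with N ≤ #S, fourierCoef (listFun l) S ^ 2 ≤ δ) :
    ∃ 𝒮 : Finset (Finset (Fin n)),
      (#𝒮 : ℝ) * τ ≤ 2 * (8 * m) ^ N * (5 / 4) ^ v₀ ∧
      ∑ S ∈ 𝒮ᶜ, fourierCoef (listFun l) S ^ 2
        ≤ δ + 2 * τ * (2 * (8 * m) ^ N * (5 / 4) ^ v₀)
          + 4 * (6 * (8 * m)) ^ N * (5 / 6) ^ v₀ := by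
  classical
  have hm' : (7 : ℝ) ≤ m := by exact_mod_cast hm
  choose a b hab ha hb haa hbb using exists_branch_bounds hkm l hread v₀
  set c : Finset (Fin n) → ℝ := fun S =>
    (∑ y, if queried l S y = S then (4 / 5 : ℝ) ^ wide m l ∅ S y else 0) / 2 ^ n with hc
  have hc0 : ∀ S, 0 ≤ c S := fun S => by positivity
  have hsum : ∑ S, (1 / (8 * m : ℝ)) ^ #S * c S ≤ 2 :=
    sum_full_branches_le m W (by positivity) (by norm_num) (fun t _ => wideCost_weight_le hm t)
      l hsat hW
  have hcN : ∑ S with #S < N, c S ≤ 2 * (8 * m) ^ N := by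
    calc ∑ S with #S < N, c S
        ≤ ∑ S with #S < N, (8 * m : ℝ) ^ N * ((1 / (8 * m : ℝ)) ^ #S * c S) := by
          refine Finset.sum_le_sum fun S hS => ?_
          have hS' := (mem_filter.1 hS).2
          have : (1 : ℝ) ≤ (8 * m : ℝ) ^ N * (1 / (8 * m : ℝ)) ^ #S := by
            rw [one_div, inv_pow, ← div_eq_mul_inv, one_le_div (by positivity)]
            exact pow_le_pow_right₀ (by linarith) hS'.le
          rw [← mul_assoc]
          exact le_mul_of_one_le_left (hc0 S) this
      _ ≤ ∑ S, (8 * m : ℝ) ^ N * ((1 / (8 * m : ℝ)) ^ #S * c S) :=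
          Finset.sum_le_sum_of_subset_of_nonneg (filter_subset _ _) fun S _ _ => by
            have := hc0 S
            positivity
      _ ≤ (8 * m : ℝ) ^ N * 2 := by
          rw [← Finset.mul_sum]
          gcongr
      _ = _ := mul_comm _ _
  have hasum : ∑ S with #S < N, a S ≤ 2 * (8 * m) ^ N * (5 / 4) ^ v₀ := by
    calc ∑ S with #S < N, a S ≤ ∑ S with #S < N, (5 / 4) ^ v₀ * c S :=
          Finset.sum_le_sum fun S _ => haa S
      _ ≤ (5 / 4) ^ v₀ * (2 * (8 * m) ^ N) := by
          rw [← Finset.mul_sum]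
          gcongr
      _ = _ := by ring
  have hbsum : ∑ S with #S < N, b S ^ 2 ≤ 2 * (6 * (8 * m)) ^ N * (5 / 6) ^ v₀ := by
    calc ∑ S with #S < N, b S ^ 2 ≤ ∑ S with #S < N, 6 ^ N * (5 / 6) ^ v₀ * c S := by
          refine Finset.sum_le_sum fun S hS => (hbb S).trans ?_
          rw [← mul_assoc]
          have := hc0 S
          have hS' := (mem_filter.1 hS).2.le
          gcongr
          norm_num
      _ ≤ 6 ^ N * (5 / 6) ^ v₀ * (2 * (8 * m) ^ N) := by
          rw [← Finset.mul_sum]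
          gcongr
      _ = _ := by
          rw [mul_pow 6 (8 * (m : ℝ)) N]
          ring
  refine ⟨({S | #S < N ∧ τ ≤ a S} : Finset (Finset (Fin n))), ?_, ?_⟩
  · refine le_trans ?_ hasum
    rw [← nsmul_eq_mul, ← Finset.sum_const]
    calc _ ≤ ∑ S with #S < N ∧ τ ≤ a S, a S :=
          Finset.sum_le_sum fun S hS => (mem_filter.1 hS).2.2
      _ ≤ _ := Finset.sum_le_sum_of_subset_of_nonneg
          (fun S hS => mem_filter.2 ⟨mem_univ _, (mem_filter.1 hS).2.1⟩) fun S _ _ => ha S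
  · have hpt : ∀ S ∈ ({S | #S < N ∧ τ ≤ a S} : Finset (Finset (Fin n)))ᶜ,
        fourierCoef (listFun l) S ^ 2 ≤ (if N ≤ #S then fourierCoef (listFun l) S ^ 2 else 0)
          + (if #S < N then 2 * τ * a S + 2 * b S ^ 2 else 0) := fun S hS => by
      by_cases hN : N ≤ #S
      · simp [hN, not_lt.2 hN]
      · have hN' := not_le.1 hN
        have haτ : a S < τ := by simpa [hN'] using hS
        simp only [hN, hN', if_true, if_false, zero_add]
        have h1 : fourierCoef (listFun l) S ^ 2 ≤ (a S + b S) ^ 2 := sq_le_sq.2 (by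
          rw [abs_of_nonneg (add_nonneg (ha S) (hb S))]
          exact hab S)
        nlinarith [sq_nonneg (a S - b S), ha S]
    calc _ ≤ ∑ S, ((if N ≤ #S then fourierCoef (listFun l) S ^ 2 else 0)
          + (if #S < N then 2 * τ * a S + 2 * b S ^ 2 else 0)) := by
          refine (Finset.sum_le_sum hpt).trans (Finset.sum_le_sum_of_subset_of_nonneg
            (subset_univ _) fun S _ _ => ?_)
          have := ha S
          positivity
      _ = ∑ S with N ≤ #S, fourierCoef (listFun l) S ^ 2
          + (2 * τ * ∑ S with #S < N, a S + 2 * ∑ S with #S < N, b S ^ 2) := by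
          rw [Finset.sum_add_distrib, ← Finset.sum_filter, ← Finset.sum_filter,
            Finset.sum_add_distrib, Finset.mul_sum, Finset.mul_sum]
      _ ≤ δ + (2 * τ * (2 * (8 * m) ^ N * (5 / 4) ^ v₀)
          + 2 * (2 * (6 * (8 * m)) ^ N * (5 / 6) ^ v₀)) := by gcongr
      _ = _ := by ring

/-! ### Truncation and parameters -/

lemma toFun_eq_zero_or_one {n s : ℕ} (φ : DNF n s) (y : Cube n) :
    φ.toFun y = 0 ∨ φ.toFun y = 1 := by
  unfold DNF.toFun
  split_ifs <;> simp

lemma toFun_sq {n s : ℕ} (φ : DNF n s) (y : Cube n) : φ.toFun y ^ 2 = φ.toFun y := by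
  rcases toFun_eq_zero_or_one φ y with h | h <;> simp [h]

lemma sum_toFun_le {n s : ℕ} (φ : DNF n s) : (∑ y, φ.toFun y) / 2 ^ n ≤ 1 := by
  rw [div_le_one (by positivity)]
  calc ∑ y, φ.toFun y ≤ ∑ _y : Cube n, (1 : ℝ) := Finset.sum_le_sum fun y _ => by
        rcases toFun_eq_zero_or_one φ y with h | h <;> simp [h]
    _ = 2 ^ n := by simp

/-- The Fourier weight of a Boolean function off `∅` is its variance. -/
lemma sum_fourierCoef_sq_ne_empty_le {n s : ℕ} (φ : DNF n s) :
    ∑ S ∈ ({∅} : Finset (Finset (Fin n)))ᶜ, fourierCoef φ.toFun S ^ 2 ≤ 1 / 4 := by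
  have h1 := Finset.sum_add_sum_compl ({∅} : Finset (Finset (Fin n)))
    fun S => fourierCoef φ.toFun S ^ 2
  have h2 : fourierCoef φ.toFun ∅ = (∑ y, φ.toFun y) / 2 ^ n := by simp [fourierCoef, monomialAt]
  rw [sum_fourierCoef_sq, Finset.sum_singleton, h2] at h1
  simp_rw [toFun_sq] at h1
  nlinarith [sq_nonneg ((∑ y, φ.toFun y) / 2 ^ n - 1 / 2)]

/-- A read-`0` DNF computes a constant function. -/
lemma sum_fourierCoef_sq_of_read_zero {n s : ℕ} (φ : DNF n s) (hφ : φ.IsRead 0) :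
    ∑ S ∈ ({∅} : Finset (Finset (Fin n)))ᶜ, fourierCoef φ.toFun S ^ 2 = 0 := by
  have hempty : ∀ j, φ j = ∅ := fun j => by
    refine eq_empty_of_forall_notMem fun x hx => ?_
    have h := Finset.card_eq_zero.1 (Nat.le_zero.1 (hφ x.1))
    have : j ∈ univ.filter fun j : Fin s => x.1 ∈ Term.vars (φ j) :=
      mem_filter.2 ⟨mem_univ _, Term.mem_vars hx⟩
    rw [h] at this
    exact absurd this (notMem_empty _)
  have hsat : ∀ j y, Term.Sat (φ j) y := fun j y x hx => by
    rw [hempty j] at hx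
    exact absurd hx (notMem_empty x)
  have hind : IndepOf univ φ.toFun := fun y z _ => by simp only [DNF.toFun, hsat]
  refine Finset.sum_eq_zero fun S hS => ?_
  have hS' : (S ∩ univ).Nonempty := by
    rw [inter_univ, nonempty_iff_ne_empty]
    simpa using hS
  rw [fourierCoef, sum_indepOf_mul_monomialAt hind hS']
  simp

open Classical in
/-- The satisfiable terms of `φ` with at most `W` variables. -/
noncomputable def truncate {n s : ℕ} (φ : DNF n s) (W : ℕ) : List (Term n) :=
  (List.ofFn φ).filter fun T => (∃ y, T.Sat y) ∧ #T.vars ≤ W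

lemma mem_truncate {n s W : ℕ} {φ : DNF n s} {T : Term n} :
    T ∈ truncate φ W ↔ (∃ j, φ j = T) ∧ (∃ y, T.Sat y) ∧ #T.vars ≤ W := by
  simp [truncate, List.mem_ofFn]

open Classical in
lemma card_truncate_mem_vars_le {n s k W : ℕ} {φ : DNF n s} (hφ : φ.IsRead k) (i : Fin n) :
    #((truncate φ W).toFinset.filter fun T => i ∈ T.vars) ≤ k := by
  have : (truncate φ W).toFinset.filter (fun T => i ∈ T.vars)
      ⊆ (univ.filter fun j : Fin s => i ∈ Term.vars (φ j)).image φ := fun T hT => by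
    rw [mem_filter, List.mem_toFinset, mem_truncate] at hT
    obtain ⟨⟨⟨j, rfl⟩, -⟩, hi⟩ := hT
    exact mem_image_of_mem _ (mem_filter.2 ⟨mem_univ _, hi⟩)
  exact (card_le_card this).trans (card_image_le.trans (by convert hφ i))

open Classical in
lemma sum_sq_toFun_sub_truncate_le {n s : ℕ} (φ : DNF n s) (W : ℕ) :
    (∑ y, (φ.toFun y - listFun (truncate φ W) y) ^ 2) / 2 ^ n ≤ s / 2 ^ W := by
  have hpt : ∀ y, (φ.toFun y - listFun (truncate φ W) y) ^ 2
      ≤ ∑ j, if W < #(φ j).vars ∧ (φ j).Sat y then (1 : ℝ) else 0 := fun y => by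
    have h0 : ∀ j, (0 : ℝ) ≤ if W < #(φ j).vars ∧ (φ j).Sat y then (1 : ℝ) else 0 := fun j => by
      positivity
    by_cases h1 : ∃ T ∈ truncate φ W, T.Sat y
    · have h2 : ∃ j, Term.Sat (φ j) y := by
        obtain ⟨T, hT, hy⟩ := h1
        obtain ⟨⟨j, rfl⟩, -⟩ := mem_truncate.1 hT
        exact ⟨j, hy⟩
      rw [DNF.toFun, listFun, if_pos h1, if_pos h2]
      simp
    · by_cases h2 : ∃ j, Term.Sat (φ j) y
      · obtain ⟨j, hj⟩ := h2
        have hW : W < #(φ j).vars := by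
          by_contra hW
          exact h1 ⟨φ j, mem_truncate.2 ⟨⟨j, rfl⟩, ⟨y, hj⟩, not_lt.1 hW⟩, hj⟩
        rw [DNF.toFun, listFun, if_neg h1, if_pos ⟨j, hj⟩]
        refine le_trans (le_of_eq ?_) (Finset.single_le_sum (fun j _ => h0 j) (mem_univ j))
        rw [if_pos ⟨hW, hj⟩]
        norm_num
      · rw [DNF.toFun, listFun, if_neg h1, if_neg h2]
        simp
  have hj : ∀ j, (∑ y, if W < #(φ j).vars ∧ (φ j).Sat y then (1 : ℝ) else 0) ≤ 2 ^ n / 2 ^ W := by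
    intro j
    by_cases hW : W < #(φ j).vars
    · have h := card_satOff_mul_le {φ j} ∅
      have h1 : #{y : Cube n | (φ j).Sat y} * 2 ^ #(φ j).vars ≤ 2 ^ n := by
        simpa [Term.SatOff, Term.Sat] using h
      have h2 : #{y : Cube n | (φ j).Sat y} * 2 ^ W ≤ 2 ^ n :=
        le_trans (Nat.mul_le_mul_left _ (Nat.pow_le_pow_right two_pos hW.le)) h1
      rw [le_div_iff₀ (by positivity)]
      simp only [hW, true_and]
      rw [← Finset.sum_filter, Finset.sum_const, nsmul_eq_mul, mul_one]
      exact_mod_cast h2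
    · simp only [hW, false_and, if_false, Finset.sum_const_zero]
      positivity
  rw [div_le_iff₀ (by positivity)]
  calc _ ≤ ∑ y, ∑ j, (if W < #(φ j).vars ∧ (φ j).Sat y then (1 : ℝ) else 0) :=
        Finset.sum_le_sum fun y _ => hpt y
    _ ≤ ∑ _j : Fin s, (2 : ℝ) ^ n / 2 ^ W := by
        rw [Finset.sum_comm]
        exact Finset.sum_le_sum fun j _ => hj j
    _ = _ := by
        rw [Finset.sum_const, card_univ, Fintype.card_fin, nsmul_eq_mul]
        ring

/-- Replacing `f` by `g` costs twice the squared `L²`-distance. -/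
lemma sum_fourierCoef_sq_le_of_approx {n : ℕ} (f g : Cube n → ℝ) (𝒯 : Finset (Finset (Fin n))) :
    ∑ S ∈ 𝒯, fourierCoef f S ^ 2
      ≤ 2 * ∑ S ∈ 𝒯, fourierCoef g S ^ 2 + 2 * ((∑ y, (f y - g y) ^ 2) / 2 ^ n) := by
  have hadd : ∀ S, fourierCoef f S = fourierCoef g S + fourierCoef (fun y => f y - g y) S :=
    fun S => by
      simp only [fourierCoef]
      rw [← add_div, ← Finset.sum_add_distrib]
      congr 1
      exact Finset.sum_congr rfl fun y _ => by ring
  rw [← sum_fourierCoef_sq fun y => f y - g y, Finset.mul_sum, Finset.mul_sum]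
  calc _ ≤ ∑ S ∈ 𝒯, (2 * fourierCoef g S ^ 2 + 2 * fourierCoef (fun y => f y - g y) S ^ 2) := by
        refine Finset.sum_le_sum fun S _ => ?_
        rw [hadd S]
        nlinarith [sq_nonneg (fourierCoef g S - fourierCoef (fun y => f y - g y) S)]
    _ ≤ _ := by
        rw [Finset.sum_add_distrib]
        gcongr
        exact subset_univ _

lemma half_le_logb_logb {k : ℕ} (hk : 1 ≤ k) : 3 / 2 ≤ Real.logb 2 ((k : ℝ) + 2) ∧
    1 / 2 ≤ Real.logb 2 (Real.logb 2 ((k : ℝ) + 2)) := by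
  have h : ∀ x : ℝ, 0 < x → ∀ a : ℕ, (2 : ℝ) ^ a ≤ x ^ 2 → (a : ℝ) / 2 ≤ Real.logb 2 x := by
    intro x hx a ha
    have h1 : (a : ℝ) ≤ Real.logb 2 (x ^ 2) := by
      rw [Real.le_logb_iff_rpow_le (by norm_num) (by positivity), Real.rpow_natCast]
      exact ha
    rw [Real.logb_pow] at h1
    push_cast at h1
    linarith
  have hk' : (1 : ℝ) ≤ k := by exact_mod_cast hk
  have h1 : 3 / 2 ≤ Real.logb 2 ((k : ℝ) + 2) := by
    have := h ((k : ℝ) + 2) (by positivity) 3 (by nlinarith)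
    norm_num at this ⊢
    exact this
  refine ⟨h1, ?_⟩
  have := h (Real.logb 2 ((k : ℝ) + 2)) (by linarith) 1 (by nlinarith)
  norm_num at this ⊢
  exact this

/-- A DNF of width `W` has Fourier weight `O(2 ^ (-t))` at degrees `O(W * t)` and above. -/
lemma sum_fourierCoef_sq_high_le_of_width {n W : ℕ} (hW0 : 0 < W) (l : List (Term n))
    (hsat : ∀ T ∈ l, ∃ y, T.Sat y) (hW : ∀ T ∈ l, #T.vars ≤ W) (t : ℕ) :
    ∑ S with 32 * W * (t + 1) ≤ #S, fourierCoef (listFun l) S ^ 2 ≤ 4 / 2 ^ t := by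
  have hW1 : (1 : ℝ) ≤ W := by exact_mod_cast hW0
  have hWpos : (0 : ℝ) < W := by linarith
  exact sum_fourierCoef_sq_high_le (W := W) (p := 1 / (16 * W)) (by positivity)
    (by rw [div_le_one (by positivity)]; linarith) (fun r hr => by
      have : (1 + 4 * (1 / (16 * W)) : ℝ) ^ r ≤ 3 / 2 := by
        refine one_add_pow_le (by positivity) ?_
        have : (r : ℝ) ≤ W := by exact_mod_cast hr
        rw [show (r : ℝ) * (4 * (1 / (16 * W))) = r / W / 4 by field_simp; norm_num]
        have : (r : ℝ) / W ≤ 1 := (div_le_one hWpos).2 this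
        linarith
      linarith) l hsat hW t (32 * W * (t + 1)) (by
      have h2 : (1 - 1 / (16 * W) / 2 : ℝ) ^ (32 * W * (t + 1)) ≤ (1 / 2) ^ (t + 1) := by
        rw [pow_mul]
        refine pow_le_pow_left₀ (pow_nonneg ?_ _) ?_ _
        · have : 1 / (16 * W : ℝ) ≤ 1 := by
            rw [div_le_one (by positivity)]
            linarith
          linarith
        · calc (1 - 1 / (16 * W) / 2 : ℝ) ^ (32 * W)
              ≤ Real.exp (-(1 / (16 * W) / 2)) ^ (32 * W) := by
                refine pow_le_pow_left₀ ?_ ?_ _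
                · have : 1 / (16 * W : ℝ) ≤ 1 := by
                    rw [div_le_one (by positivity)]
                    linarith
                  linarith
                · have := Real.add_one_le_exp (-(1 / (16 * W) / 2 : ℝ))
                  linarith
            _ = Real.exp (-1) := by
                rw [← Real.exp_nat_mul]
                congr 1
                push_cast
                field_simp
                norm_num
            _ ≤ 1 / 2 := by
                rw [Real.exp_neg, one_div]
                gcongr
                linarith [Real.exp_one_gt_d9]
      calc _ ≤ (2 : ℝ) ^ t * (1 / 2) ^ (t + 1) := by gcongr
        _ = 1 / 2 := by
          rw [pow_succ, ← mul_assoc, ← mul_pow]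
          norm_num)

/-- The Fourier weight carried by the branches with at least `v₀` variables in wide terms is
negligible for `v₀ ≥ 84 * x`. -/
lemma four_mul_mul_pow_le {ε L x y : ℝ} {v₀ : ℕ} (hε : 0 < ε) (two_rpow_L : (2 : ℝ) ^ L = 1 / ε)
    (hy0 : 0 ≤ y) (hy : y ≤ 2 ^ (19 * x)) (hv1 : 84 * x ≤ v₀) (hLx : L + 5 ≤ 2 * x) :
    4 * y * (5 / 6) ^ v₀ ≤ ε / 8 := by
  have h1 : (2 : ℝ) ^ (21 * x) ≤ (6 / 5) ^ v₀ := by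
    calc (2 : ℝ) ^ (21 * x) ≤ 2 ^ ((v₀ : ℝ) / 4) :=
          Real.rpow_le_rpow_of_exponent_le (by norm_num) (by linarith)
      _ ≤ ((6 / 5) ^ (4 : ℝ)) ^ ((v₀ : ℝ) / 4) := by
          gcongr
          norm_num
      _ = (6 / 5) ^ v₀ := by
          rw [← Real.rpow_mul (by norm_num), ← Real.rpow_natCast]
          congr 1
          ring
  have h2 : 32 / ε * y ≤ (6 / 5) ^ v₀ := by
    refine le_trans ?_ h1
    calc 32 / ε * y ≤ 2 ^ (L + 5) * 2 ^ (19 * x) := by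
          refine mul_le_mul ?_ hy hy0 (by positivity)
          rw [Real.rpow_add (by norm_num), two_rpow_L]
          norm_num
          exact le_of_eq (by ring)
      _ = 2 ^ (L + 5 + 19 * x) := (Real.rpow_add (by norm_num) _ _).symm
      _ ≤ 2 ^ (21 * x) :=
          Real.rpow_le_rpow_of_exponent_le (by norm_num) (by linarith)
  have h3 : ((5 : ℝ) / 6) ^ v₀ = 1 / (6 / 5) ^ v₀ := by
    rw [one_div, ← inv_pow]
    norm_num
  rw [h3, mul_one_div, div_le_iff₀ (by positivity)]
  rw [div_mul_eq_mul_div, div_le_iff₀ hε] at h2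
  linarith

/-- The number of sets in the family, in terms of the exponents of all quantities to base `2`. -/
lemma sixteen_mul_sq_div_le {ε r M L Λ ℓ x v : ℝ} (two_rpow_L : (2 : ℝ) ^ L = 1 / ε)
    (two_rpow_Λ : (2 : ℝ) ^ Λ = r) (hM0 : 0 ≤ M) (hM : M ≤ 2 ^ (1 + 19 * x + v)) (hv : v ≤ 86 * x)
    (hLx : L + 6 ≤ 2 * x) (hx : x ≤ 432 * (Λ * L) * ℓ) (h0 : 0 ≤ Λ * L * ℓ) :
    16 * M ^ 2 / ε ≤ r ^ (100000 * ℓ * L) := by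
  calc 16 * M ^ 2 / ε = 2 ^ (4 + L) * M ^ 2 := by
        rw [Real.rpow_add (by norm_num), two_rpow_L]
        norm_num
        ring
    _ ≤ 2 ^ (4 + L) * (2 ^ (1 + 19 * x + v)) ^ 2 := by gcongr
    _ = 2 ^ (4 + L + 2 * (1 + 19 * x + v)) := by
        rw [← Real.rpow_natCast, ← Real.rpow_mul (by norm_num), ← Real.rpow_add (by norm_num)]
        congr 1
        push_cast
        ring
    _ ≤ 2 ^ (Λ * (100000 * ℓ * L)) :=
        Real.rpow_le_rpow_of_exponent_le (by norm_num) (by linarith)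
    _ = r ^ (100000 * ℓ * L) := by rw [Real.rpow_mul (by norm_num), two_rpow_Λ]

/-- The choice of parameters: terms of more than `O(log (s / ε))` variables are dropped, degrees
`N = O(log (s / ε) * log (1 / ε))` and above are ignored, terms are wide from `m = O(log k)`
variables on, and branches with `v₀ = O(N * log log k)` variables in wide terms are negligible. -/
lemma concentrated_of_small {n s k : ℕ} (φ : DNF n s) (hφ : φ.IsRead k) {ε : ℝ} (hε : 0 < ε)
    (hε4 : ε < 1 / 4) (hs : 1 ≤ s) (hk : 1 ≤ k) :
    ConcentratedOnCoefficients φ.toFun ε (((s : ℝ) / ε) ^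
      (100000 * Real.logb 2 (Real.logb 2 ((k : ℝ) + 2)) * Real.logb 2 (1 / ε))) := by
  classical
  have hs' : (1 : ℝ) ≤ s := by exact_mod_cast hs
  have hsε : 0 < (s : ℝ) / ε := by positivity
  obtain ⟨hκ, hℓ⟩ := half_le_logb_logb hk
  set κ := Real.logb 2 ((k : ℝ) + 2) with hκdef
  set ℓ := Real.logb 2 κ with hℓdef
  set L := Real.logb 2 (1 / ε) with hLdef
  set Λ := Real.logb 2 ((s : ℝ) / ε) with hΛdef
  have two_rpow_L : (2 : ℝ) ^ L = 1 / ε := Real.rpow_logb (by norm_num) (by norm_num) (by positivity)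
  have two_rpow_Λ : (2 : ℝ) ^ Λ = s / ε := Real.rpow_logb (by norm_num) (by norm_num) hsε
  have two_rpow_κ : (2 : ℝ) ^ κ = k + 2 :=
    Real.rpow_logb (by norm_num) (by norm_num) (by positivity)
  have two_rpow_ℓ : (2 : ℝ) ^ ℓ = κ := Real.rpow_logb (by norm_num) (by norm_num) (by linarith)
  have hL : 2 ≤ L := by
    rw [hLdef, Real.le_logb_iff_rpow_le (by norm_num) (by positivity), le_div_iff₀ hε]
    norm_num
    linarith
  have hLΛ : L ≤ Λ := by
    refine Real.logb_le_logb_of_le (by norm_num) (by positivity) ?_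
    gcongr
  -- the parameters
  obtain ⟨W, hW1, hW2⟩ : ∃ W : ℕ, Λ + 3 ≤ W ∧ (W : ℝ) ≤ Λ + 4 :=
    ⟨⌈Λ + 3⌉₊, Nat.le_ceil _, by linarith [Nat.ceil_lt_add_one (show 0 ≤ Λ + 3 by linarith)]⟩
  obtain ⟨t, ht1, ht2⟩ : ∃ t : ℕ, L + 5 ≤ t ∧ (t : ℝ) ≤ L + 6 :=
    ⟨⌈L + 5⌉₊, Nat.le_ceil _, by linarith [Nat.ceil_lt_add_one (show 0 ≤ L + 5 by linarith)]⟩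
  obtain ⟨j, hj1, hj2⟩ : ∃ j : ℕ, κ ≤ j ∧ (j : ℝ) ≤ κ + 1 :=
    ⟨⌈κ⌉₊, Nat.le_ceil _, by linarith [Nat.ceil_lt_add_one (show 0 ≤ κ by linarith)]⟩
  have hWpos : (0 : ℝ) < W := by linarith
  set N : ℕ := 32 * W * (t + 1) with hN
  have hNr : (N : ℝ) = 32 * W * (t + 1) := by
    rw [hN]
    push_cast
    ring
  have hN1 : L + 6 ≤ N := by
    rw [hNr]
    nlinarith
  have hN2 : (N : ℝ) ≤ 432 * (Λ * L) := by
    have h1 : (W : ℝ) ≤ 3 * Λ := by linarith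
    have h2 : (t : ℝ) + 1 ≤ 9 / 2 * L := by linarith
    calc (N : ℝ) = 32 * W * (t + 1) := hNr
      _ ≤ 32 * (3 * Λ) * (9 / 2 * L) := by
        have : 0 ≤ Λ := by linarith
        gcongr
      _ = 432 * (Λ * L) := by ring
  have hN0 : (0 : ℝ) ≤ N := Nat.cast_nonneg N
  have hNℓ : (N : ℝ) ≤ 2 * (N * ℓ) := by nlinarith
  obtain ⟨v₀, hv1, hv2⟩ : ∃ v₀ : ℕ, 84 * (N * ℓ) ≤ v₀ ∧ (v₀ : ℝ) ≤ 86 * (N * ℓ) :=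
    ⟨⌈84 * (N * ℓ)⌉₊, Nat.le_ceil _, by
      linarith [Nat.ceil_lt_add_one (show 0 ≤ 84 * (N * ℓ) by positivity)]⟩
  -- `m ≥ 3 * log₂ k` since `(3 / 4) ^ 3 ≤ 1 / 2`, and `m ≥ 7` as needed by `wideCost_weight_le`
  set m : ℕ := 3 * j + 7 with hm
  have hmr : (m : ℝ) = 3 * j + 7 := by
    rw [hm]
    push_cast
    ring
  have hkm : (k : ℝ) * (3 / 4) ^ m ≤ 1 := by
    have h1 : (k : ℝ) ≤ 2 ^ j := by
      calc (k : ℝ) ≤ 2 ^ κ := by linarith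
        _ ≤ 2 ^ (j : ℝ) := Real.rpow_le_rpow_of_exponent_le (by norm_num) hj1
        _ = 2 ^ j := Real.rpow_natCast _ _
    calc (k : ℝ) * (3 / 4) ^ m ≤ 2 ^ j * (3 / 4) ^ (3 * j) := by
          gcongr ?_ * ?_
          exact pow_le_pow_of_le_one (by norm_num) (by norm_num) (by omega)
      _ = (2 * (3 / 4) ^ 3) ^ j := by rw [pow_mul, mul_pow]
      _ ≤ 1 := pow_le_one₀ (by norm_num) (by norm_num)
  have h48 : (48 * m : ℝ) ≤ 2 ^ (19 * ℓ) := by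
    calc (48 * m : ℝ) ≤ 2 ^ (9 : ℝ) * κ := by
          rw [hmr]
          norm_num
          linarith
      _ = 2 ^ (9 + ℓ) := by rw [Real.rpow_add (by norm_num), two_rpow_ℓ]
      _ ≤ 2 ^ (19 * ℓ) := Real.rpow_le_rpow_of_exponent_le (by norm_num) (by linarith)
  have h48N : (48 * m : ℝ) ^ N ≤ 2 ^ (19 * (N * ℓ)) := by
    calc (48 * m : ℝ) ^ N ≤ (2 ^ (19 * ℓ)) ^ N := by gcongr
      _ = 2 ^ (19 * (N * ℓ)) := by
        rw [← Real.rpow_natCast, ← Real.rpow_mul (by norm_num)]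
        congr 1
        ring
  -- the high degrees
  have htail : ∑ S with N ≤ #S, fourierCoef (listFun (truncate φ W)) S ^ 2 ≤ ε / 8 := by
    refine (sum_fourierCoef_sq_high_le_of_width (by exact_mod_cast hWpos) (truncate φ W)
      (fun T hT => (mem_truncate.1 hT).2.1) (fun T hT => (mem_truncate.1 hT).2.2) t).trans ?_
    have h2 : 32 / ε ≤ (2 : ℝ) ^ t := by
      calc 32 / ε = 2 ^ (L + 5) := by
            rw [Real.rpow_add (by norm_num), two_rpow_L]
            norm_num
            ring
        _ ≤ 2 ^ (t : ℝ) := Real.rpow_le_rpow_of_exponent_le (by norm_num) ht1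
        _ = 2 ^ t := Real.rpow_natCast _ _
    rw [div_le_iff₀ hε] at h2
    rw [div_le_iff₀ (by positivity)]
    linarith
  -- the dropped terms
  have htrunc : (∑ y, (φ.toFun y - listFun (truncate φ W) y) ^ 2) / 2 ^ n ≤ ε / 8 := by
    refine (sum_sq_toFun_sub_truncate_le φ W).trans ?_
    have h2 : 8 * (s / ε) ≤ (2 : ℝ) ^ W := by
      calc 8 * (s / ε) = 2 ^ (Λ + 3) := by
            rw [Real.rpow_add (by norm_num), two_rpow_Λ]
            norm_num
            ring
        _ ≤ 2 ^ (W : ℝ) := Real.rpow_le_rpow_of_exponent_le (by norm_num) hW1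
        _ = 2 ^ W := Real.rpow_natCast _ _
    rw [← mul_div_assoc, div_le_iff₀ hε] at h2
    rw [div_le_iff₀ (by positivity)]
    linarith
  set M : ℝ := 2 * (8 * m) ^ N * (5 / 4) ^ v₀ with hM
  have hMpos : 0 < M := by
    have : (0 : ℝ) < m := by rw [hmr]; positivity
    positivity
  -- this threshold makes the sets left out with a small weight of full branches contribute `ε / 8`
  obtain ⟨𝒮, hcard, hsum⟩ := exists_family (W := W) (m := m) (by omega) hkm (truncate φ W)
    (fun T hT => (mem_truncate.1 hT).2.1) (fun T hT => (mem_truncate.1 hT).2.2)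
    (fun i => by convert card_truncate_mem_vars_le (W := W) hφ i) v₀ N (τ := ε / (16 * M))
    (by positivity) htail
  rw [← hM] at hcard hsum
  -- the branches with many variables in wide terms
  have hwide : 4 * (6 * (8 * m) : ℝ) ^ N * (5 / 6) ^ v₀ ≤ ε / 8 := by
    rw [show (6 * (8 * m) : ℝ) = 48 * m by ring]
    exact four_mul_mul_pow_le hε two_rpow_L (by positivity) h48N hv1 (by linarith)
  refine ⟨𝒮, ?_, ?_⟩
  · have h1 : (#𝒮 : ℝ) ≤ 16 * M ^ 2 / ε := by
      rw [mul_div_assoc', div_le_iff₀ (by positivity)] at hcard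
      rw [le_div_iff₀ hε]
      linarith
    have h2 : M ≤ 2 ^ (1 + 19 * (N * ℓ) + v₀) := by
      rw [Real.rpow_add (by norm_num), Real.rpow_add (by norm_num), Real.rpow_one,
        Real.rpow_natCast, hM]
      gcongr
      · refine le_trans ?_ h48N
        gcongr
        norm_num
      · norm_num
    have hΛ : 0 ≤ Λ := by linarith
    exact h1.trans (sixteen_mul_sq_div_le two_rpow_L two_rpow_Λ hMpos.le h2 hv2 (by linarith)
      (mul_le_mul_of_nonneg_right hN2 (by linarith)) (by positivity))
  · refine (sum_fourierCoef_sq_le_of_approx φ.toFun (listFun (truncate φ W)) 𝒮ᶜ).trans ?_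
    have h1 : 2 * (ε / (16 * M)) * M = ε / 8 := by
      field_simp
      norm_num
    rw [h1] at hsum
    linarith

theorem theorem1 :
    ∃ C : ℝ, 0 < C ∧
      ∀ (n s k : ℕ) (φ : DNF n s), DNF.IsRead φ k →
        ∀ ε : ℝ, 0 < ε →
          ConcentratedOnCoefficients (DNF.toFun φ) ε
            (((s : ℝ) / ε) ^
              (C * Real.logb 2 (Real.logb 2 ((k : ℝ) + 2)) * Real.logb 2 (1 / ε))) := by
  refine ⟨100000, by norm_num, fun n s k φ hφ ε hε => ?_⟩
  rcases le_or_gt 1 ε with hε1 | hε1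
  · refine ⟨∅, ?_, ?_⟩
    · rw [card_empty, Nat.cast_zero]
      positivity
    · rw [ConcentratedOnFamily, compl_empty, sum_fourierCoef_sq]
      simp_rw [toFun_sq]
      exact (sum_toFun_le φ).trans hε1
  rcases Nat.eq_zero_or_pos s with rfl | hs
  · refine ⟨∅, ?_, ?_⟩
    · rw [card_empty, Nat.cast_zero]
      positivity
    · have h0 : ∀ y, φ.toFun y = 0 := fun y => by simp [DNF.toFun]
      rw [ConcentratedOnFamily, compl_empty, sum_fourierCoef_sq]
      simp [h0, hε.le]
  rcases Nat.eq_zero_or_pos k with rfl | hk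
  · -- the exponent vanishes since `log₂ log₂ 2 = 0`, so exactly one set is allowed
    refine ⟨{∅}, by simp, ?_⟩
    rw [ConcentratedOnFamily, sum_fourierCoef_sq_of_read_zero φ hφ]
    exact hε.le
  rcases lt_or_ge ε (1 / 4) with hε4 | hε4
  · exact concentrated_of_small φ hφ hε hε4 hs hk
  · refine ⟨{∅}, ?_, (sum_fourierCoef_sq_ne_empty_le φ).trans hε4⟩
    rw [card_singleton, Nat.cast_one]
    have hs' : (1 : ℝ) ≤ s := by exact_mod_cast hs
    refine Real.one_le_rpow ((one_le_div hε).2 (by linarith)) ?_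
    have h1 := (half_le_logb_logb hk).2
    have h2 : 0 ≤ Real.logb 2 (1 / ε) :=
      Real.logb_nonneg (by norm_num) ((one_le_div hε).2 hε1.le)
    positivity
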